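/- \textbf{Theorem (Moon in a puddle, Ionin--Pestov).} Let $a<b$ and let $\gamma\colon[a,b]\to\mathbb{R}^2$ be a simple smooth regular plane loop; that is, $\gamma$ has derivatives of all orders on $[a,b]$ (one-sided at the ends), $\gamma'(t)\neq 0$ for every $t\in[a,b]$, $\gamma(a)=\gamma(b)$, and $\gamma$ is injective on $[a,b)$. (The velocities at $a$ and $b$ need not agree, so the closed curve may have a corner or a cusp at its base $\gamma(a)=\gamma(b)$.) Suppose that the absolute curvature of $\gamma$ is at most $1$ at every $t\in[a,b]$, where the absolute curvature is $\kappa(t)=|T'(t)|/|\gamma'(t)|$ with $T=\gamma'/|\gamma'|$. Then $\gamma$ surrounds a unit disc: there is a closed disc of radius $1$ contained in the closed region bounded by $\gamma$, that is, in the union of the curve $\gamma([a,b])$ and the bounded connected component of its complement. -/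

import Mathlib

open scoped ContDiff

/-- The Euclidean plane. -/
abbrev Plane : Type := EuclideanSpace ℝ (Fin 2)

/-- `γ` restricted to `[a, b]` is a simple smooth regular plane loop with base `γ a = γ b`.
Smoothness and velocity at the ends `a`, `b` are one-sided, and nothing relates the velocities
(or higher derivatives) at `a` and at `b`: the closed curve may have a corner or a cusp at its
base. -/
structure IsSimpleSmoothRegularLoop (γ : ℝ → Plane) (a b : ℝ) : Prop where
  lt : a < b
  smooth : ContDiffOn ℝ ∞ γ (Set.Icc a b)
  regular : ∀ t ∈ Set.Icc a b, derivWithin γ (Set.Icc a b) t ≠ 0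
  closed : γ a = γ b
  simple : Set.InjOn γ (Set.Ico a b)

/-- The unit tangent vector `γ' / |γ'|` of a regular curve defined on the interval `I`. -/
noncomputable def unitTangent (γ : ℝ → Plane) (I : Set ℝ) (t : ℝ) : Plane :=
  ‖derivWithin γ I t‖⁻¹ • derivWithin γ I t

/-- The absolute curvature of a regular curve defined on the interval `I`: the magnitude of the
derivative of its unit tangent vector with respect to arc length (`ds = |γ'| dt`). For a
unit-speed curve this is `|γ''|`. -/
noncomputable def absCurvature (γ : ℝ → Plane) (I : Set ℝ) (t : ℝ) : ℝ :=
  ‖derivWithin (unitTangent γ I) I t‖ / ‖derivWithin γ I t‖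

/-- The region inside a closed curve with trace `Γ`: the points of the complement of `Γ` whose
connected component in the complement is bounded. -/
def insideRegion (Γ : Set Plane) : Set Plane :=
  {x | x ∉ Γ ∧ Bornology.IsBounded (connectedComponentIn Γᶜ x)}

/-- A closed curve with trace `Γ` surrounds the set `D` if `D` lies in the closed region bounded by
the curve, that is, in the union of the curve with the region inside it. -/
def Surrounds (Γ D : Set Plane) : Prop :=
  D ⊆ Γ ∪ insideRegion Γ

/-! Suppose that no unit disc is inscribed. At an interior time `m`, the largest inscribed disc
tangent to the loop at `f m` from inside has radius less than `1`. Bounded curvature keeps the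
nearby curve outside the unit discs tangent at `f m` (`exists_isLocallyOutside`), so the smaller
disc is stopped by a contact `f n` with `|n - m| > δ`, where `δ` does not depend on `m`
(`IsTouching.lt_abs_sub`).

If such a disc, with center `c`, touches at `f s` and `f t`, its radii to these points form a
crosscut of the loop. Take the disc tangent at the midpoint time `m`. Segments from distinct centers
to distinct nearest points are disjoint, so its radii cannot cross the crosscut, and its second
contact lies on the arc between `f s` and `f t`. The parameter gap is thereby at least halved
(`IsTouching.exists_halving`), and iteration contradicts the bound `δ`. Tangency is used only at the
first contact, an interior time, so a corner or cusp at the base is harmless.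

The topology comes from the index integral instead of the Jordan curve theorem. Off the loop it is
locally constant with values in `2πiℤ`; it jumps by `2πi` across the loop (`tendsto_jump`), its
value on each side is constant along the loop, and one side has value `0`. Being inside means having
nonzero index. A crosscut splits the index integral into a chord and a cochord integral. The first
is constant on the complementary arc, the second on the arc from `f s` to `f t`, and these two
constants add up to `0` (`exists_chordIntegral_add_eq_zero`). A disc touching both arcs would
transport both constants to its center, which would then have index `0` (`mem_image_of_touch`). -/

open Set Filter Topology

/-! ### Index integrals along `C¹` curves -/

/-- `f` is a continuously differentiable plane curve with velocity `f'`. -/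
structure IsC1Curve (f f' : ℝ → ℂ) : Prop where
  deriv : ∀ t, HasDerivAt f (f' t) t
  cont : Continuous f'

/-- The integral of `dw / (w - z)` along the curve `f` from time `s` to time `t`. -/
noncomputable def indexIntegral (f f' : ℝ → ℂ) (s t : ℝ) (z : ℂ) : ℂ :=
  ∫ u in s..t, f' u / (f u - z)

namespace IsC1Curve

variable {f f' : ℝ → ℂ}

theorem continuous (hf : IsC1Curve f f') : Continuous f :=
  continuous_iff_continuousAt.2 fun t => (hf.deriv t).continuousAt

theorem hasStrictDerivAt (hf : IsC1Curve f f') (t : ℝ) : HasStrictDerivAt f (f' t) t :=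
  hasStrictDerivAt_of_hasDerivAt_of_continuousAt (Eventually.of_forall hf.deriv)
    hf.cont.continuousAt

theorem intervalIntegrable (hf : IsC1Curve f f') {s t : ℝ} {z : ℂ}
    (hz : ∀ u ∈ uIcc s t, f u ≠ z) :
    IntervalIntegrable (fun u => f' u / (f u - z)) MeasureTheory.volume s t :=
  ContinuousOn.intervalIntegrable <| hf.cont.continuousOn.div
    (hf.continuous.sub continuous_const).continuousOn fun u hu => sub_ne_zero.2 (hz u hu)

theorem indexIntegral_add (hf : IsC1Curve f f') {r s t : ℝ} (hrs : r ≤ s) (hst : s ≤ t) {z : ℂ}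
    (hz : ∀ u ∈ Icc r t, f u ≠ z) :
    indexIntegral f f' r s z + indexIntegral f f' s t z = indexIntegral f f' r t z :=
  intervalIntegral.integral_add_adjacent_intervals
    (hf.intervalIntegrable fun u hu => hz u (by rw [uIcc_of_le hrs] at hu; exact ⟨hu.1, hu.2.trans hst⟩))
    (hf.intervalIntegrable fun u hu => hz u (by rw [uIcc_of_le hst] at hu; exact ⟨hrs.trans hu.1, hu.2⟩))

/-- The product of `f v - z` and `exp (-indexIntegral f f' s v z)` has zero derivative in `v`. For
closed curves this is what makes the index integral a multiple of `2πi`. -/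
theorem exp_indexIntegral (hf : IsC1Curve f f') {s t : ℝ} (hst : s ≤ t) {z : ℂ}
    (hz : ∀ u ∈ Icc s t, f u ≠ z) :
    Complex.exp (indexIntegral f f' s t z) = (f t - z) / (f s - z) := by
  have hm : MeasureTheory.StronglyMeasurable (fun u => f' u / (f u - z)) :=
    (hf.cont.measurable.div (hf.continuous.measurable.sub measurable_const)).stronglyMeasurable
  have hder : ∀ u ∈ Icc s t,
      HasDerivAt (fun v => (f v - z) * Complex.exp (-indexIntegral f f' s v z)) 0 u := by
    intro u hu
    have hne := sub_ne_zero.2 (hz u hu)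
    have h1 : HasDerivAt (fun v => indexIntegral f f' s v z) (f' u / (f u - z)) u := by
      refine intervalIntegral.integral_hasDerivAt_right
        (hf.intervalIntegrable fun v hv => hz v ?_) hm.stronglyMeasurableAtFilter ?_
      · rw [uIcc_of_le hu.1] at hv; exact ⟨hv.1, hv.2.trans hu.2⟩
      · exact hf.cont.continuousAt.div (hf.continuous.continuousAt.sub continuousAt_const) hne
    have h2 := ((hf.deriv u).sub_const z).mul h1.neg.cexp
    refine h2.congr_deriv ?_
    field_simp
    ring
  have hconst := constant_of_has_deriv_right_zero
    (f := fun v => (f v - z) * Complex.exp (-indexIntegral f f' s v z)) (a := s) (b := t)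
    (fun u hu => (hder u hu).continuousAt.continuousWithinAt)
    (fun u hu => (hder u ⟨hu.1, hu.2.le⟩).hasDerivWithinAt) t ⟨hst, le_rfl⟩
  have h0 : indexIntegral f f' s s z = 0 := intervalIntegral.integral_same
  simp only [h0, neg_zero, Complex.exp_zero, mul_one] at hconst
  have hs := sub_ne_zero.2 (hz s ⟨le_rfl, hst⟩)
  rw [eq_div_iff hs, ← hconst, mul_comm, mul_assoc, ← Complex.exp_add]
  simp

theorem isClosed_image (hf : IsC1Curve f f') (s t : ℝ) : IsClosed (f '' Icc s t) :=
  (isCompact_Icc.image hf.continuous).isClosed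

theorem continuousAt_indexIntegral (hf : IsC1Curve f f') {s t : ℝ} (hst : s ≤ t) {z : ℂ}
    (hz : z ∉ f '' Icc s t) : ContinuousAt (indexIntegral f f' s t) z := by
  obtain ⟨d, hd, hball⟩ := Metric.isOpen_iff.1 (hf.isClosed_image s t).isOpen_compl z hz
  obtain ⟨M, hM⟩ := (isCompact_Icc (a := s) (b := t)).exists_bound_of_continuousOn
    hf.cont.continuousOn
  have hfar : ∀ w ∈ Metric.ball z (d / 2), ∀ u ∈ Icc s t, d / 2 ≤ ‖f u - w‖ := by
    intro w hw u hu
    by_contra! h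
    refine hball (a := f u) ?_ ⟨u, hu, rfl⟩
    rw [Metric.mem_ball, dist_eq_norm] at *
    calc ‖f u - z‖ = ‖(f u - w) + (w - z)‖ := by ring_nf
      _ ≤ _ := norm_add_le _ _
      _ < d := by linarith
  refine intervalIntegral.continuousAt_of_dominated_interval (bound := fun _ => M / (d / 2))
    ?_ ?_ intervalIntegrable_const ?_
  · refine Eventually.of_forall fun w => Measurable.aestronglyMeasurable ?_
    exact hf.cont.measurable.div (hf.continuous.measurable.sub measurable_const)
  · filter_upwards [Metric.ball_mem_nhds z (half_pos hd)] with w hw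
    refine Eventually.of_forall fun u hu => ?_
    rw [uIoc_of_le hst] at hu
    have hu' : u ∈ Icc s t := ⟨hu.1.le, hu.2⟩
    rw [norm_div]
    exact div_le_div₀ ((norm_nonneg _).trans (hM u hu')) (hM u hu') (half_pos hd) (hfar w hw u hu')
  · refine Eventually.of_forall fun u hu => ?_
    rw [uIoc_of_le hst] at hu
    refine continuousAt_const.div (continuousAt_const.sub continuousAt_id) (sub_ne_zero.2 ?_)
    rintro h
    exact hz ⟨u, ⟨hu.1.le, hu.2⟩, h⟩

theorem hasDerivAt_log_comp (hf : IsC1Curve f f') {e z : ℂ} {u : ℝ}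
    (h : e * (f u - z) ∈ Complex.slitPlane) :
    HasDerivAt (fun v => Complex.log (e * (f v - z))) (f' u / (f u - z)) u := by
  have h1 := (((hf.deriv u).sub_const z).const_mul e).clog_real h
  have hne := Complex.slitPlane_ne_zero h
  have he : e ≠ 0 := left_ne_zero_of_mul hne
  rwa [mul_div_mul_left _ _ he] at h1

theorem indexIntegral_eq_log_sub (hf : IsC1Curve f f') {e z : ℂ} {s t : ℝ} (hst : s ≤ t)
    (h : ∀ u ∈ Icc s t, e * (f u - z) ∈ Complex.slitPlane) :
    indexIntegral f f' s t z = Complex.log (e * (f t - z)) - Complex.log (e * (f s - z)) := by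
  refine intervalIntegral.integral_eq_sub_of_hasDerivAt
    (f := fun u => Complex.log (e * (f u - z))) (fun u hu => ?_)
    (hf.intervalIntegrable fun u hu => ?_)
  · rw [uIcc_of_le hst] at hu; exact hf.hasDerivAt_log_comp (h u hu)
  · rw [uIcc_of_le hst] at hu
    exact sub_ne_zero.1 (right_ne_zero_of_mul (Complex.slitPlane_ne_zero (h u hu)))

end IsC1Curve

/-! ### The jump of the index integral across a curve -/

theorem Complex.log_sub_log_neg_of_im_pos {w : ℂ} (h : 0 < w.im) :
    Complex.log w - Complex.log (-w) = Real.pi * Complex.I := by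
  simp only [Complex.log, norm_neg, Complex.arg_neg_eq_arg_sub_pi_of_im_pos h]
  push_cast; ring

theorem Complex.log_sub_log_neg_of_im_neg {w : ℂ} (h : w.im < 0) :
    Complex.log w - Complex.log (-w) = -(Real.pi * Complex.I) := by
  simp only [Complex.log, norm_neg, Complex.arg_neg_eq_arg_add_pi_of_im_neg h]
  push_cast; ring

namespace IsC1Curve

variable {f f' : ℝ → ℂ}

/-- Near a regular time `m`, the curve progresses strictly in the direction `f' m`. -/
theorem exists_strictMonoOn_re (hf : IsC1Curve f f') {m : ℝ} (hm : f' m ≠ 0) :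
    ∃ ε > 0, StrictMonoOn (fun u => ((f u - f m) / f' m).re) (Icc (m - ε) (m + ε)) := by
  have hd : ∀ u, HasDerivAt (fun u => ((f u - f m) / f' m).re) (f' u / f' m).re u := fun u =>
    Complex.reCLM.hasFDerivAt.comp_hasDerivAt u (((hf.deriv u).sub_const _).div_const _)
  have hc : Continuous fun u => (f' u / f' m).re :=
    Complex.continuous_re.comp (hf.cont.div_const _)
  have hpos : ∀ᶠ u in 𝓝 m, 0 < (f' u / f' m).re := by
    refine hc.continuousAt.eventually_mem (Ioi_mem_nhds ?_)
    simp [div_self hm]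
  obtain ⟨ε, hε, hb⟩ := Metric.eventually_nhds_iff.1 hpos
  refine ⟨ε, hε, strictMonoOn_of_deriv_pos (convex_Icc _ _)
    (fun u _ => (hd u).continuousAt.continuousWithinAt) fun u hu => ?_⟩
  rw [interior_Icc] at hu
  rw [(hd u).deriv]
  exact hb (by rw [Real.dist_eq, abs_lt]; constructor <;> linarith [hu.1, hu.2])

/-- Crossing a curve from its left to its right at a simple regular point lowers the index
integral by `2πi`. -/
theorem tendsto_jump (hf : IsC1Curve f f') {s t m : ℝ} (hsm : s < m) (hmt : m < t)
    (hm : f' m ≠ 0) (hinj : ∀ u ∈ Icc s t, f u = f m → u = m) :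
    Tendsto (fun h : ℝ => indexIntegral f f' s t (f m + f' m * (h * Complex.I)) -
      indexIntegral f f' s t (f m + f' m * (-h * Complex.I))) (𝓝[>] 0)
      (𝓝 (2 * Real.pi * Complex.I)) := by
  obtain ⟨ε₀, hε₀, hmono₀⟩ := hf.exists_strictMonoOn_re hm
  obtain ⟨ε, hε, hεε, hεs, hεt⟩ : ∃ ε > 0, ε ≤ ε₀ ∧ s ≤ m - ε ∧ m + ε ≤ t :=
    ⟨min ε₀ (min (m - s) (t - m)), by simp [*], min_le_left _ _,
      by linarith [min_le_right ε₀ (min (m - s) (t - m)), min_le_left (m - s) (t - m)],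
      by linarith [min_le_right ε₀ (min (m - s) (t - m)), min_le_right (m - s) (t - m)]⟩
  have hmono := hmono₀.mono (Icc_subset_Icc (by linarith : m - ε₀ ≤ m - ε)
    (by linarith : m + ε ≤ m + ε₀))
  have hmm : m ∈ Icc (m - ε) (m + ε) := ⟨by linarith, by linarith⟩
  set D := f' m with hD
  have him : ∀ u ∈ Icc (m - ε) (m + ε), u ≠ m → ((f u - f m) / D).re ≠ 0 := by
    intro u hu hne h0
    exact hne (hmono.injOn hu hmm (by simpa using h0))
  have him1 : 0 < ((f (m + ε) - f m) / D).re := by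
    have := hmono hmm ⟨by linarith, le_rfl⟩ (by linarith : m < m + ε)
    simpa using this
  have him2 : ((f (m - ε) - f m) / D).re < 0 := by
    have := hmono ⟨le_rfl, by linarith⟩ hmm (by linarith : m - ε < m)
    simpa using this
  -- the two logarithms
  have key : ∀ σ : ℝ, σ = 1 ∨ σ = -1 → Tendsto (fun h : ℝ =>
      indexIntegral f f' s t (f m + D * (σ * h * Complex.I))) (𝓝[>] 0)
      (𝓝 (indexIntegral f f' s (m - ε) (f m) + indexIntegral f f' (m + ε) t (f m)
        + (Complex.log (σ * (Complex.I * ((f (m + ε) - f m) / D)))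
          - Complex.log (σ * (Complex.I * ((f (m - ε) - f m) / D)))))) := by
    intro σ hσ
    have hlim : Tendsto (fun h : ℝ => f m + D * (σ * h * Complex.I)) (𝓝[>] 0) (𝓝 (f m)) := by
      have : Continuous fun h : ℝ => f m + D * (σ * h * Complex.I) := by fun_prop
      simpa using (this.tendsto 0).mono_left nhdsWithin_le_nhds
    -- After multiplication by `σ * I / D` the short arc around `m` avoids the branch cut: the
    -- imaginary part vanishes only at `u = m`, where the value is `h > 0`. So its contribution is
    -- an explicit difference of logarithms, while the two outer arcs contribute continuously.
    have hslit : ∀ u ∈ Icc (m - ε) (m + ε), ∀ h : ℝ, 0 < h →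
        (σ * Complex.I / D) * (f u - (f m + D * (σ * h * Complex.I))) ∈ Complex.slitPlane := by
      intro u hu h hh
      have e : (σ * Complex.I / D) * (f u - (f m + D * (σ * h * Complex.I))) =
          σ * (Complex.I * ((f u - f m) / D)) + h := by
        have hσ2 : (σ : ℂ) ^ 2 = 1 := by rcases hσ with rfl | rfl <;> norm_num
        field_simp
        linear_combination (-h * D) * Complex.I ^ 2 * hσ2 + (-h * D) * Complex.I_sq
      rw [e, Complex.mem_slitPlane_iff]
      by_cases hum : u = m
      · left; simp [hum, hh]
      · right
        have := him u hu hum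
        rcases hσ with rfl | rfl <;> simpa using this
    have hA : ContinuousAt (indexIntegral f f' s (m - ε)) (f m) :=
      hf.continuousAt_indexIntegral hεs (by
        rintro ⟨u, hu, h⟩
        have := hinj u ⟨hu.1, by linarith [hu.2]⟩ h
        linarith [hu.2])
    have hB : ContinuousAt (indexIntegral f f' (m + ε) t) (f m) :=
      hf.continuousAt_indexIntegral hεt (by
        rintro ⟨u, hu, h⟩
        have := hinj u ⟨by linarith [hu.1], hu.2⟩ h
        linarith [hu.1])
    have hL : ∀ u : ℝ, ((f u - f m) / D).re ≠ 0 → Tendsto (fun h : ℝ =>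
        Complex.log ((σ * Complex.I / D) * (f u - (f m + D * (σ * h * Complex.I)))))
        (𝓝[>] 0) (𝓝 (Complex.log (σ * (Complex.I * ((f u - f m) / D))))) := by
      intro u hu
      have e : σ * (Complex.I * ((f u - f m) / D)) = (σ * Complex.I / D) * (f u - f m) := by ring
      rw [e]
      refine Tendsto.clog (tendsto_const_nhds.mul (tendsto_const_nhds.sub hlim)) ?_
      rw [← e, Complex.mem_slitPlane_iff]
      right
      rcases hσ with rfl | rfl <;> simpa using hu
    have hsum := ((hA.tendsto.comp hlim).add (hB.tendsto.comp hlim)).add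
      ((hL (m + ε) him1.ne').sub (hL (m - ε) him2.ne))
    refine hsum.congr' ?_
    have hnA : ∀ᶠ h : ℝ in 𝓝[>] 0, f m + D * (σ * h * Complex.I) ∉ f '' Icc s (m - ε) :=
      hlim.eventually ((hf.isClosed_image _ _).isOpen_compl.mem_nhds (by
        rintro ⟨u, hu, h⟩
        have := hinj u ⟨hu.1, by linarith [hu.2]⟩ h
        linarith [hu.2]))
    have hnB : ∀ᶠ h : ℝ in 𝓝[>] 0, f m + D * (σ * h * Complex.I) ∉ f '' Icc (m + ε) t :=
      hlim.eventually ((hf.isClosed_image _ _).isOpen_compl.mem_nhds (by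
        rintro ⟨u, hu, h⟩
        have := hinj u ⟨by linarith [hu.1], hu.2⟩ h
        linarith [hu.1]))
    filter_upwards [hnA, hnB, self_mem_nhdsWithin] with h h1 h2 h3
    have hmid : ∀ u ∈ Icc (m - ε) (m + ε), f u ≠ f m + D * (σ * h * Complex.I) := fun u hu =>
      sub_ne_zero.1 (right_ne_zero_of_mul (Complex.slitPlane_ne_zero (hslit u hu h h3)))
    have hall : ∀ u ∈ Icc s t, f u ≠ f m + D * (σ * h * Complex.I) := by
      intro u hu e
      rcases le_total u (m - ε) with h' | h'
      · exact h1 ⟨u, ⟨hu.1, h'⟩, e⟩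
      rcases le_total (m + ε) u with h'' | h''
      · exact h2 ⟨u, ⟨h'', hu.2⟩, e⟩
      · exact hmid u ⟨h', h''⟩ e
    rw [← hf.indexIntegral_add (by linarith : s ≤ m + ε) hεt hall,
      ← hf.indexIntegral_add hεs (by linarith : m - ε ≤ m + ε)
        (fun u hu => hall u ⟨hu.1, hu.2.trans hεt⟩),
      hf.indexIntegral_eq_log_sub (by linarith : m - ε ≤ m + ε) (fun u hu => hslit u hu h h3)]
    simp only [Function.comp]
    ring
  have h1 := key 1 (Or.inl rfl)
  have h2 := key (-1) (Or.inr rfl)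
  have h3 := h1.sub h2
  have e1 := Complex.log_sub_log_neg_of_im_pos (w := Complex.I * ((f (m + ε) - f m) / D))
    (by simpa using him1)
  have e2 := Complex.log_sub_log_neg_of_im_neg (w := Complex.I * ((f (m - ε) - f m) / D))
    (by simpa using him2)
  convert h3 using 2
  · simp
  · push_cast
    simp only [one_mul, neg_mul] at *
    linear_combination -e1 + e2

end IsC1Curve

/-! ### Values of the index integral on the two sides of a simple loop -/

/-- A continuous function with values in `2πiℤ` is constant on preconnected sets. -/
theorem IsPreconnected.eq_of_two_pi_I_int {α : Type*} [TopologicalSpace α] {S : Set α}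
    (hS : IsPreconnected S) {g : α → ℂ} (hg : ContinuousOn g S)
    (hint : ∀ z ∈ S, ∃ n : ℤ, g z = n * (2 * Real.pi * Complex.I)) {x y : α} (hx : x ∈ S)
    (hy : y ∈ S) : g x = g y := by
  have hpi : (2 * Real.pi * Complex.I : ℂ) ≠ 0 := Complex.two_pi_I_ne_zero
  have hc : ContinuousOn (fun z => (g z / (2 * Real.pi * Complex.I)).re) S :=
    Complex.continuous_re.comp_continuousOn (hg.div_const _)
  have hd : DiscreteTopology (range ((↑) : ℤ → ℝ)) :=
    (Int.isClosedEmbedding_coe_real.isEmbedding.toHomeomorph.symm.isEmbedding).discreteTopology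
  have hmaps : MapsTo (fun z => (g z / (2 * Real.pi * Complex.I)).re) S (range ((↑) : ℤ → ℝ)) := by
    intro z hz
    obtain ⟨n, hn⟩ := hint z hz
    exact ⟨n, by simp only [hn]; rw [mul_div_cancel_right₀ _ hpi]; simp⟩
  have h := hS.constant_of_mapsTo ⟨hd⟩ hc hmaps hx hy
  obtain ⟨n, hn⟩ := hint x hx
  obtain ⟨k, hk⟩ := hint y hy
  simp only [hn, hk] at h ⊢
  rw [mul_div_cancel_right₀ _ hpi, mul_div_cancel_right₀ _ hpi] at h
  simp only [Complex.intCast_re, Int.cast_inj] at h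
  rw [h]

/-- `f` is a simple regular `C¹` plane loop on `[a, b]`, extended to the whole line as a regular
`C¹` curve. -/
structure IsSimpleC1Loop (f f' : ℝ → ℂ) (a b : ℝ) : Prop extends IsC1Curve f f' where
  lt : a < b
  ne : ∀ t, f' t ≠ 0
  closed : f a = f b
  inj : InjOn f (Ico a b)

namespace IsSimpleC1Loop

variable {f f' : ℝ → ℂ} {a b : ℝ}

theorem eq_of_eq (hf : IsSimpleC1Loop f f' a b) {m u : ℝ} (hm : m ∈ Ioo a b) (hu : u ∈ Icc a b)
    (h : f u = f m) : u = m := by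
  rcases hu.2.lt_or_eq with hb | rfl
  · exact hf.inj ⟨hu.1, hb⟩ ⟨hm.1.le, hm.2⟩ h
  · have := hf.inj ⟨le_rfl, hf.lt⟩ ⟨hm.1.le, hm.2⟩ (hf.closed.trans h)
    exact absurd this hm.1.ne

theorem int (hf : IsSimpleC1Loop f f' a b) {z : ℂ} (hz : z ∉ f '' Icc a b) :
    ∃ n : ℤ, indexIntegral f f' a b z = n * (2 * Real.pi * Complex.I) := by
  have hz' : ∀ u ∈ Icc a b, f u ≠ z := fun u hu h => hz ⟨u, hu, h⟩
  have h := hf.exp_indexIntegral hf.lt.le hz'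
  rw [← hf.closed, div_self (sub_ne_zero.2 (hz' a ⟨le_rfl, hf.lt.le⟩))] at h
  exact Complex.exp_eq_one_iff.1 h

theorem continuousOn (hf : IsSimpleC1Loop f f' a b) :
    ContinuousOn (indexIntegral f f' a b) (f '' Icc a b)ᶜ :=
  fun _ hz => (hf.continuousAt_indexIntegral hf.lt.le hz).continuousWithinAt

theorem eq_of_isPreconnected (hf : IsSimpleC1Loop f f' a b) {S : Set ℂ} (hS : IsPreconnected S)
    (hdisj : S ⊆ (f '' Icc a b)ᶜ) {x y : ℂ} (hx : x ∈ S) (hy : y ∈ S) :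
    indexIntegral f f' a b x = indexIntegral f f' a b y :=
  hS.eq_of_two_pi_I_int (hf.continuousOn.mono hdisj) (fun _ hz => hf.int (hdisj hz)) hx hy

/-- Far from the loop the integral has norm less than `1`, and the only multiple of `2πi` that small
is `0`. -/
theorem exists_eq_zero_of_norm_gt (hf : IsSimpleC1Loop f f' a b) :
    ∃ R : ℝ, ∀ z : ℂ, R < ‖z‖ → z ∉ f '' Icc a b ∧ indexIntegral f f' a b z = 0 := by
  obtain ⟨M, hM⟩ := (isCompact_Icc (a := a) (b := b)).exists_bound_of_continuousOn
    hf.cont.continuousOn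
  obtain ⟨M', hM'⟩ := (isCompact_Icc (a := a) (b := b)).exists_bound_of_continuousOn
    hf.continuous.continuousOn
  have ha : a ∈ Icc a b := ⟨le_rfl, hf.lt.le⟩
  have hM0 : 0 ≤ M := (norm_nonneg _).trans (hM a ha)
  have hba := sub_pos.2 hf.lt
  refine ⟨M' + M * (b - a) + 1, fun z hz => ?_⟩
  have hfar : ∀ u ∈ Icc a b, M * (b - a) + 1 ≤ ‖f u - z‖ := by
    intro u hu
    have h1 := norm_sub_norm_le z (f u)
    rw [norm_sub_rev] at h1
    linarith [hM' u hu]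
  have hpos : 0 < M * (b - a) + 1 := by positivity
  have hz : z ∉ f '' Icc a b := by
    rintro ⟨u, hu, rfl⟩
    have := hfar u hu
    simp only [sub_self, norm_zero] at this
    linarith
  refine ⟨hz, ?_⟩
  obtain ⟨n, hn⟩ := hf.int hz
  have hbd : ‖indexIntegral f f' a b z‖ ≤ M / (M * (b - a) + 1) * |b - a| := by
    refine intervalIntegral.norm_integral_le_of_norm_le_const fun u hu => ?_
    rw [uIoc_of_le hf.lt.le] at hu
    have hu' : u ∈ Icc a b := ⟨hu.1.le, hu.2⟩
    rw [norm_div]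
    exact div_le_div₀ hM0 (hM u hu') hpos (hfar u hu')
  have h1 : M / (M * (b - a) + 1) * |b - a| < 1 := by
    rw [abs_of_pos hba, div_mul_eq_mul_div, div_lt_one hpos]; linarith
  have hn0 : n = 0 := by
    by_contra h0
    have h2 : (1 : ℝ) ≤ |(n : ℝ)| := by exact_mod_cast Int.one_le_abs h0
    have h3 : ‖indexIntegral f f' a b z‖ = |(n : ℝ)| * (2 * Real.pi) := by
      rw [hn]; simp [abs_of_pos Real.pi_pos]
    nlinarith [Real.pi_gt_three]
  simp [hn, hn0]

theorem eq_zero_of_unbounded (hf : IsSimpleC1Loop f f' a b) {S : Set ℂ} (hS : IsPreconnected S)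
    (hdisj : S ⊆ (f '' Icc a b)ᶜ) (hub : ¬ Bornology.IsBounded S) {x : ℂ} (hx : x ∈ S) :
    indexIntegral f f' a b x = 0 := by
  obtain ⟨R, hR⟩ := hf.exists_eq_zero_of_norm_gt
  obtain ⟨y, hy, hyR⟩ : ∃ y ∈ S, R < ‖y‖ := by
    by_contra! h
    exact hub ((isBounded_iff_forall_norm_le).2 ⟨R, h⟩)
  rw [hf.eq_of_isPreconnected hS hdisj hx hy, (hR y hyR).2]

/-- Points near a regular point, off the tangential cone, are off the loop. -/
theorem exists_cone (hf : IsSimpleC1Loop f f' a b) {m : ℝ} (hm : m ∈ Ioo a b) :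
    ∃ ε > 0, Ioo (m - ε) (m + ε) ⊆ Ioo a b ∧ ∀ u ∈ Ioo (m - ε) (m + ε), ∀ x y : ℝ, |x| ≤ |y| →
      y ≠ 0 → |y| < ε → f u + f' m * (x + y * Complex.I) ∉ f '' Icc a b := by
  set D := f' m with hD
  have hD0 : 0 < ‖D‖ := norm_pos_iff.2 (hf.ne m)
  -- With relative error `1/8`, a point `f v` of the loop in the cone would give `|y| ≤ |v - u| / 8`
  -- and `|x - (v - u)| ≤ |v - u| / 8`, which contradicts `|x| ≤ |y|` and `y ≠ 0`.
  have hs := (hf.hasStrictDerivAt m).isLittleO.def (c := ‖D‖ / 8) (by positivity)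
  obtain ⟨ε₁, hε₁, hs⟩ := Metric.eventually_nhds_iff.1 hs
  -- away from `m` the curve keeps a positive distance
  have hK : IsCompact (Icc a b \ Metric.ball m ε₁) := isCompact_Icc.diff Metric.isOpen_ball
  have hKn : f m ∉ f '' (Icc a b \ Metric.ball m ε₁) := by
    rintro ⟨u, ⟨hu, hu'⟩, h⟩
    exact hu' (by rw [hf.eq_of_eq hm hu h]; exact Metric.mem_ball_self hε₁)
  obtain ⟨η, hη, hball⟩ := Metric.isOpen_iff.1 (hK.image hf.continuous).isClosed.isOpen_compl _ hKn
  obtain ⟨ε₂, hε₂, hcont⟩ := Metric.continuous_iff.1 hf.continuous m (η / 2) (half_pos hη)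
  set ε := min (min ε₁ ε₂) (min (min (m - a) (b - m)) (η / (4 * ‖D‖))) with hε
  have hεpos : 0 < ε := by
    have := hm.1; have := hm.2
    simp only [hε, lt_min_iff]
    refine ⟨⟨hε₁, hε₂⟩, ⟨by linarith, by linarith⟩, by positivity⟩
  have l1 : ε ≤ ε₁ := (min_le_left _ _).trans (min_le_left _ _)
  have l2 : ε ≤ ε₂ := (min_le_left _ _).trans (min_le_right _ _)
  have l3 : ε ≤ m - a := (min_le_right _ _).trans ((min_le_left _ _).trans (min_le_left _ _))
  have l4 : ε ≤ b - m := (min_le_right _ _).trans ((min_le_left _ _).trans (min_le_right _ _))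
  have l5 : ε ≤ η / (4 * ‖D‖) := (min_le_right _ _).trans (min_le_right _ _)
  refine ⟨ε, hεpos, Ioo_subset_Ioo (by linarith) (by linarith), ?_⟩
  rintro u hu x y hxy hy0 hyε ⟨v, hv, hfv⟩
  have hum : dist u m < ε := by
    rw [Real.dist_eq, abs_lt]; constructor <;> linarith [hu.1, hu.2]
  have hdn : ‖D * (x + y * Complex.I)‖ < η / 2 := by
    rw [norm_mul]
    have h1 : ‖(x + y * Complex.I : ℂ)‖ ≤ |x| + |y| := by
      refine (norm_add_le _ _).trans ?_; simp
    have h2 : |y| < η / (4 * ‖D‖) := hyε.trans_le l5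
    rw [lt_div_iff₀ (by positivity)] at h2
    nlinarith
  have hvm : dist v m < ε₁ := by
    by_contra h
    refine hball (a := f v) ?_ ⟨v, ⟨hv, h⟩, rfl⟩
    rw [Metric.mem_ball, hfv, dist_eq_norm]
    have h2 := hcont u (hum.trans_le l2)
    rw [dist_eq_norm] at h2
    calc ‖f u + D * (x + y * Complex.I) - f m‖ = ‖(f u - f m) + D * (x + y * Complex.I)‖ := by
          ring_nf
      _ ≤ _ := norm_add_le _ _
      _ < η := by linarith
  have hlin := @hs (v, u) (by rw [Prod.dist_eq]; exact max_lt hvm (hum.trans_le l1))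
  simp only [ContinuousLinearMap.toSpanSingleton_apply, Complex.real_smul, hfv] at hlin
  -- divide by `D`
  have e : f u + D * (x + y * Complex.I) - f u - ((v - u : ℝ) : ℂ) * D =
      D * ((x - (v - u) : ℝ) + y * Complex.I) := by push_cast; ring
  rw [e, norm_mul] at hlin
  have hlin' : ‖((x - (v - u) : ℝ) + y * Complex.I : ℂ)‖ ≤ |v - u| / 8 := by
    rw [Real.norm_eq_abs] at hlin
    by_contra! h
    have := mul_lt_mul_of_pos_left h hD0
    linarith
  have hre := (Complex.abs_re_le_norm _).trans hlin'
  have him := (Complex.abs_im_le_norm _).trans hlin'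
  simp at hre him
  have hy := abs_pos.2 hy0
  rcases abs_cases (v - u) with h | h <;> rcases abs_cases x with h' | h' <;>
    rcases abs_cases (x - (v - u)) with h'' | h'' <;> linarith

/-- `k` is the value of the index integral on the side `σ` (left for `σ = 1`, right for `σ = -1`)
of the loop near time `m`. -/
def IsSideValue (f f' : ℝ → ℂ) (a b m σ : ℝ) (k : ℂ) : Prop :=
  ∃ ε > 0, ∀ u ∈ Ioo (m - ε) (m + ε), ∀ x y : ℝ, |x| ≤ y → 0 < y → y < ε →
    indexIntegral f f' a b (f u + f' m * (x + σ * y * Complex.I)) = k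

/-- The cone coordinates `(u, x, y)` range over a convex set whose image is connected and misses the
loop. -/
theorem exists_isSideValue (hf : IsSimpleC1Loop f f' a b) {m : ℝ} (hm : m ∈ Ioo a b) {σ : ℝ}
    (hσ : |σ| = 1) : ∃ k, IsSideValue f f' a b m σ k := by
  obtain ⟨ε, hε, -, hcone⟩ := hf.exists_cone hm
  have hoff : ∀ u ∈ Ioo (m - ε) (m + ε), ∀ x y : ℝ, |x| ≤ y → 0 < y → y < ε →
      f u + f' m * (x + σ * y * Complex.I) ∉ f '' Icc a b := by
    intro u hu x y hx hy hyε
    have hy' : |σ * y| = y := by rw [abs_mul, hσ, one_mul, abs_of_pos hy]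
    have := hcone u hu x (σ * y) (by rwa [hy']) (by rw [← abs_pos, hy']; exact hy) (by rwa [hy'])
    push_cast at this
    exact this
  let C : Set (ℝ × ℝ × ℝ) := {p | p.1 ∈ Ioo (m - ε) (m + ε) ∧ -p.2.2 ≤ p.2.1 ∧ p.2.1 ≤ p.2.2 ∧
    0 < p.2.2 ∧ p.2.2 < ε}
  have hC : Convex ℝ C := by
    rintro ⟨u, x, y⟩ ⟨⟨h1, h2⟩, h3, h4, h5, h6⟩ ⟨u', x', y'⟩ ⟨⟨h1', h2'⟩, h3', h4', h5', h6'⟩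
      α β hα hβ hαβ
    obtain rfl : β = 1 - α := by linarith
    simp only [C, mem_ofPred_eq, Prod.smul_mk, Prod.mk_add_mk, smul_eq_mul, mem_Ioo] at *
    refine ⟨⟨?_, ?_⟩, ?_, ?_, ?_, ?_⟩ <;>
      rcases hα.eq_or_lt with rfl | hα' <;> nlinarith
  let g : ℝ × ℝ × ℝ → ℂ := fun p => f p.1 + f' m * (p.2.1 + σ * p.2.2 * Complex.I)
  have hg : Continuous g := by
    have := hf.continuous
    fun_prop
  have hgC : MapsTo g C (f '' Icc a b)ᶜ := fun p hp =>
    hoff p.1 hp.1 p.2.1 p.2.2 (abs_le.2 ⟨hp.2.1, hp.2.2.1⟩) hp.2.2.2.1 hp.2.2.2.2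
  refine ⟨indexIntegral f f' a b (g (m, 0, ε / 2)), ε, hε, fun u hu x y hx hy hyε => ?_⟩
  refine hf.eq_of_isPreconnected (S := g '' C) (hC.isPreconnected.image g hg.continuousOn)
    hgC.image_subset (x := _) (y := _) ⟨(u, x, y), ⟨hu, (abs_le.1 hx).1, (abs_le.1 hx).2, hy, hyε⟩, rfl⟩
    ⟨(m, 0, ε / 2), ⟨⟨by simpa using hε, by simpa using hε⟩, ?_, ?_, ?_, ?_⟩, rfl⟩
  all_goals simp only
  all_goals linarith

theorem IsSideValue.eventually {m σ : ℝ} {k : ℂ} (h : IsSideValue f f' a b m σ k) :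
    ∀ᶠ y : ℝ in 𝓝[>] 0, indexIntegral f f' a b (f m + f' m * (σ * y * Complex.I)) = k := by
  obtain ⟨ε, hε, h⟩ := h
  filter_upwards [Ioo_mem_nhdsGT hε] with y hy
  have := h m ⟨by linarith, by linarith⟩ 0 y (by simpa using hy.1.le) hy.1 hy.2
  simpa using this

theorem IsSideValue.unique {m σ : ℝ} {k k' : ℂ} (h : IsSideValue f f' a b m σ k)
    (h' : IsSideValue f f' a b m σ k') : k = k' := by
  obtain ⟨y, hy, hy'⟩ := (h.eventually.and h'.eventually).exists
  exact hy.symm.trans hy'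

theorem sideValue_sub (hf : IsSimpleC1Loop f f' a b) {m : ℝ} (hm : m ∈ Ioo a b) {k k' : ℂ}
    (h : IsSideValue f f' a b m 1 k) (h' : IsSideValue f f' a b m (-1) k') :
    k - k' = 2 * Real.pi * Complex.I := by
  have hj := hf.tendsto_jump hm.1 hm.2 (hf.ne m) fun u hu => hf.eq_of_eq hm hu
  refine tendsto_nhds_unique (tendsto_const_nhds.congr' ?_) hj
  filter_upwards [h.eventually, h'.eventually] with y h1 h2
  rw [← h1, ← h2]; simp

/-- The normal at `m'`, written in the frame `f' m`, is turned by `q = f' m' / f' m`, which is close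
to `1`; it therefore stays in the cone `|x| ≤ y` of `m`. This is the reason for a cone, and not just
the normal direction, in `IsSideValue`. -/
theorem IsSideValue.eventually_isSideValue (hf : IsSimpleC1Loop f f' a b) {m σ : ℝ}
    (hm : m ∈ Ioo a b) (hσ : |σ| = 1) {k : ℂ} (h : IsSideValue f f' a b m σ k) :
    ∀ᶠ m' in 𝓝 m, IsSideValue f f' a b m' σ k := by
  obtain ⟨ε, hε, h⟩ := h
  have hq : ContinuousAt (fun m' => f' m' / f' m) m := (hf.cont.div_const _).continuousAt
  have hre : ∀ᶠ m' in 𝓝 m, |(f' m' / f' m).im| ≤ (f' m' / f' m).re ∧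
      0 < (f' m' / f' m).re := by
    have h1 : ContinuousAt (fun m' => (f' m' / f' m).re) m := Complex.continuous_re.continuousAt.comp hq
    have h2 : ContinuousAt (fun m' => |(f' m' / f' m).im|) m :=
      (Complex.continuous_im.continuousAt.comp hq).abs
    have h3 : |(f' m / f' m).im| < (f' m / f' m).re := by simp [div_self (hf.ne m)]
    filter_upwards [h2.eventually_lt h1 h3] with m' h
    exact ⟨h.le, (abs_nonneg _).trans_lt h⟩
  filter_upwards [hre, Ioo_mem_nhds hm.1 hm.2, Ioo_mem_nhds (sub_lt_self m hε) (lt_add_of_pos_right m hε)]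
    with m' hre hm' hm''
  obtain ⟨k', hk'⟩ := hf.exists_isSideValue hm' hσ
  suffices k' = k by rwa [← this]
  set q := f' m' / f' m with hqdef
  obtain ⟨y, hy1, hy0, hy2⟩ := (hk'.eventually.and (Ioo_mem_nhdsGT (div_pos hε hre.2))).exists
  rw [← hy1, ← h m' hm'' (-(σ * y * q.im)) (y * q.re) ?_ (mul_pos hy0 hre.2)
    ((lt_div_iff₀ hre.2).1 hy2)]
  · congr 2
    have hfq : f' m' = f' m * (q.re + q.im * Complex.I) := by
      rw [Complex.re_add_im, hqdef, mul_div_cancel₀ _ (hf.ne m)]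
    rw [hfq]
    push_cast
    linear_combination (f' m * q.im * σ * y) * Complex.I_sq
  · rw [abs_neg, abs_mul, abs_mul, hσ, one_mul, abs_of_pos hy0]
    exact mul_le_mul_of_nonneg_left hre.1 hy0.le

theorem IsSideValue.of_mem (hf : IsSimpleC1Loop f f' a b) {m m' σ : ℝ}
    (hm : m ∈ Ioo a b) (hm' : m' ∈ Ioo a b) (hσ : |σ| = 1) {k : ℂ}
    (h : IsSideValue f f' a b m σ k) : IsSideValue f f' a b m' σ k := by
  have := isPreconnected_Ioo.induction₂ (s := Ioo a b)
    (fun x y => ∀ k, IsSideValue f f' a b x σ k ↔ IsSideValue f f' a b y σ k)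
    (fun x hx => ?_) (fun x y z _ _ _ h1 h2 k => (h1 k).trans (h2 k))
    (fun x y _ _ h k => (h k).symm) hm hm'
  · exact (this k).1 h
  · obtain ⟨k, hk⟩ := hf.exists_isSideValue hx hσ
    refine nhdsWithin_le_nhds ((hk.eventually_isSideValue hf hx hσ).mono fun y hy k' => ?_)
    exact ⟨fun h => hk.unique h ▸ hy, fun h => hy.unique h ▸ hk⟩

/-- At a point farthest in a direction `e`, the ray along `e` is normal to the loop and escapes to
infinity without meeting it. Taking `e` from the base to another point of the loop puts this extreme
point away from the base. -/
theorem exists_isSideValue_zero (hf : IsSimpleC1Loop f f' a b) :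
    ∃ m ∈ Ioo a b, ∃ σ : ℝ, (σ = 1 ∨ σ = -1) ∧ IsSideValue f f' a b m σ 0 := by
  have hlt := hf.lt
  set x₀ := (a + b) / 2
  have hx₀ : x₀ ∈ Ioo a b := ⟨by simp only [x₀]; linarith, by simp only [x₀]; linarith⟩
  set e := f x₀ - f a with he
  have he0 : e ≠ 0 := fun h0 =>
    hx₀.1.ne (hf.eq_of_eq hx₀ ⟨le_rfl, hf.lt.le⟩ (sub_eq_zero.1 h0).symm)
  obtain ⟨m, hm, hmax⟩ := (isCompact_Icc (a := a) (b := b)).exists_isMaxOn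
    ⟨a, le_rfl, hf.lt.le⟩ (f := fun u => ((f u - f a) / e).re)
    (Complex.continuous_re.comp ((hf.continuous.sub continuous_const).div_const _)).continuousOn
  have hmax' : ∀ u ∈ Icc a b, ((f u - f a) / e).re ≤ ((f m - f a) / e).re := hmax
  have hx1 : ((f x₀ - f a) / e).re = 1 := by rw [← he, div_self he0]; simp
  have hge := hmax' x₀ (Ioo_subset_Icc_self hx₀)
  rw [hx1] at hge
  have hma : a ≠ m := by rintro rfl; simp at hge; linarith
  have hmb : m ≠ b := by rintro rfl; simp [hf.closed] at hge; linarith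
  have hmI : m ∈ Ioo a b := ⟨lt_of_le_of_ne hm.1 hma, lt_of_le_of_ne hm.2 hmb⟩
  refine ⟨m, hmI, ?_⟩
  have hd : HasDerivAt (fun u => ((f u - f a) / e).re) (f' m / e).re m :=
    Complex.reCLM.hasFDerivAt.comp_hasDerivAt m (((hf.deriv m).sub_const _).div_const _)
  have h0 : (f' m / e).re = 0 :=
    (hmax.isLocalMax (Icc_mem_nhds hmI.1 hmI.2)).hasDerivAt_eq_zero hd
  -- `f' m = i λ e`
  set lam := (f' m / e).im with hlam
  have hD : f' m = lam * Complex.I * e := by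
    have := Complex.re_add_im (f' m / e)
    rw [h0, ← hlam] at this
    rw [eq_comm, ← eq_div_iff he0, ← this]; simp
  have hlam0 : lam ≠ 0 := by rintro h; exact hf.ne m (by rw [hD, h]; simp)
  -- the outward ray
  have hray : ∀ ρ : ℝ, 0 < ρ → indexIntegral f f' a b (f m + ρ * e) = 0 := by
    intro ρ hρ
    refine hf.eq_zero_of_unbounded (S := (fun ρ : ℝ => f m + ρ * e) '' Ioi 0)
      (isPreconnected_Ioi.image _ (by fun_prop)) ?_ ?_ ⟨ρ, hρ, rfl⟩
    · rintro _ ⟨ρ, hρ, rfl⟩ ⟨u, hu, h⟩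
      have h1 := hmax' u hu
      have h2 : (f u - f a) / e = (f m - f a) / e + ρ := by
        simp only [h]; field_simp; ring
      rw [h2] at h1
      simp only [Complex.add_re, Complex.ofReal_re] at h1
      have : 0 < ρ := hρ
      linarith
    · intro hbd
      obtain ⟨R, hR⟩ := isBounded_iff_forall_norm_le.1 hbd
      have hen := norm_pos_iff.2 he0
      have hR0 : 0 ≤ R := (norm_nonneg _).trans (hR _ ⟨1, mem_Ioi.2 zero_lt_one, rfl⟩)
      have h1 := hR _ ⟨(R + ‖f m‖ + 1) / ‖e‖, div_pos (by positivity) hen, rfl⟩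
      have h2 := norm_sub_norm_le (((R + ‖f m‖ + 1) / ‖e‖ : ℝ) * e) (-f m)
      rw [sub_neg_eq_add, add_comm _ (f m), norm_neg, norm_mul, Complex.norm_real,
        Real.norm_of_nonneg (by positivity), div_mul_cancel₀ _ hen.ne'] at h2
      linarith
  obtain ⟨σ, hσ, hσl⟩ : ∃ σ : ℝ, (σ = 1 ∨ σ = -1) ∧ σ * lam < 0 := by
    rcases hlam0.lt_or_gt with h | h
    · exact ⟨1, Or.inl rfl, by linarith⟩
    · exact ⟨-1, Or.inr rfl, by linarith⟩
  refine ⟨σ, hσ, ?_⟩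
  obtain ⟨k, hk⟩ := hf.exists_isSideValue hmI (σ := σ) (by rcases hσ with rfl | rfl <;> simp)
  obtain ⟨y, hy, hy0⟩ := (hk.eventually.and self_mem_nhdsWithin).exists
  have hy0 : 0 < y := hy0
  have hz := hray (-(σ * lam * y)) (by nlinarith)
  have e1 : f m + ((-(σ * lam * y) : ℝ) : ℂ) * e = f m + f' m * (σ * y * Complex.I) := by
    rw [hD]; push_cast
    linear_combination (-(lam * e * σ * y)) * Complex.I_sq
  rw [e1, hy] at hz
  rwa [← hz]

/-- A nonzero value of the index integral on the side `σ` of the loop is `2πiσ`. -/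
theorem IsSideValue.eq_of_ne_zero (hf : IsSimpleC1Loop f f' a b) {m σ : ℝ} (hm : m ∈ Ioo a b)
    (hσ : σ = 1 ∨ σ = -1) {k : ℂ} (h : IsSideValue f f' a b m σ k) (hk : k ≠ 0) :
    k = 2 * Real.pi * Complex.I * σ := by
  obtain ⟨x, hx, τ, hτ, h0⟩ := hf.exists_isSideValue_zero
  have h0 := h0.of_mem hf hx hm (by rcases hτ with rfl | rfl <;> simp)
  rcases hσ with rfl | rfl <;> rcases hτ with rfl | rfl
  · exact absurd (h.unique h0) hk
  · have := hf.sideValue_sub hm h h0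
    simpa using this
  · have := hf.sideValue_sub hm h0 h
    push_cast; linear_combination -this
  · exact absurd (h.unique h0) hk

theorem exists_sideValue_ne_zero (hf : IsSimpleC1Loop f f' a b) {m : ℝ} (hm : m ∈ Ioo a b) :
    ∃ σ : ℝ, (σ = 1 ∨ σ = -1) ∧ ∃ k, k ≠ 0 ∧ IsSideValue f f' a b m σ k := by
  obtain ⟨k, hk⟩ := hf.exists_isSideValue hm (σ := 1) (by simp)
  obtain ⟨k', hk'⟩ := hf.exists_isSideValue hm (σ := -1) (by simp)
  by_cases h : k = 0
  · refine ⟨-1, Or.inr rfl, k', ?_, hk'⟩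
    rintro rfl
    have := hf.sideValue_sub hm hk hk'
    rw [h, sub_zero] at this
    exact Complex.two_pi_I_ne_zero this.symm
  · exact ⟨1, Or.inl rfl, k, h, hk⟩

end IsSimpleC1Loop

/-! ### Segments to nearest points -/

section NearestPoints

variable {E : Type*} [NormedAddCommGroup E] [NormedSpace ℝ E] {X : Set E}

/-- The segment from a point to a nearest point of `X` meets `X` only at its end. -/
theorem notMem_of_mem_segment_of_nearest {c x z : E} (hx : ∀ y ∈ X, dist c x ≤ dist c y)
    (hz : z ∈ segment ℝ c x) (hzx : z ≠ x) : z ∉ X := by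
  intro h
  have h1 := dist_add_dist_of_mem_segment hz
  have h2 := hx z h
  have h3 := dist_pos.2 hzx
  linarith

/-- Segments from distinct points to distinct nearest points of `X` are disjoint. -/
theorem disjoint_segment_of_nearest [StrictConvexSpace ℝ E] {c c' x x' : E} (hxX : x ∈ X)
    (hxX' : x' ∈ X) (hx : ∀ y ∈ X, dist c x ≤ dist c y) (hx' : ∀ y ∈ X, dist c' x' ≤ dist c' y)
    (hc : c ≠ c') (hne : x ≠ x') : Disjoint (segment ℝ c x) (segment ℝ c' x') := by
  -- At a common point `z` the two minimality conditions force `dist z x = dist z x'` and put `z`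
  -- between `c` and `x'` as well. If `z ≠ c`, strict convexity places `x` and `x'` on one ray from
  -- `z`, hence `x = x'`. So `z = c`, and by symmetry `z = c'`.
  have aux : ∀ {c c' x x' : E}, x ∈ X → x' ∈ X → (∀ y ∈ X, dist c x ≤ dist c y) →
      (∀ y ∈ X, dist c' x' ≤ dist c' y) → x ≠ x' → ∀ z ∈ segment ℝ c x, z ∈ segment ℝ c' x' →
      z = c := by
    intro c c' x x' hxX hxX' hx hx' hne z hz hz'
    have h1 := dist_add_dist_of_mem_segment hz
    have h2 := dist_add_dist_of_mem_segment hz'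
    have h3 := hx x' hxX'
    have h4 := hx' x hxX
    have h5 := dist_triangle c z x'
    have h6 := dist_triangle c' z x
    have h7 : dist c z + dist z x' = dist c x' := by linarith
    by_contra hzc
    have hw : Wbtw ℝ c z x := mem_segment_iff_wbtw.1 hz
    have hw' : Wbtw ℝ c z x' := dist_add_dist_eq_iff.1 h7
    refine hne ?_
    have hzc' : z ≠ c := hzc
    have hr : SameRay ℝ (x - z) (x' - z) := by
      have r1 : SameRay ℝ (z - c) (x - z) := by simpa using hw.sameRay_vsub
      have r2 : SameRay ℝ (z - c) (x' - z) := by simpa using hw'.sameRay_vsub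
      exact r1.symm.trans r2 fun h => absurd (sub_eq_zero.1 h) hzc'
    have hn : ‖x - z‖ = ‖x' - z‖ := by
      rw [← dist_eq_norm, ← dist_eq_norm, dist_comm x, dist_comm x']; linarith
    have := hr.eq_of_norm_eq hn
    simpa using this
  rw [Set.disjoint_left]
  intro z hz hz'
  exact hc ((aux hxX hxX' hx hx' hne z hz hz').symm.trans (aux hxX' hxX hx' hx hne.symm z hz' hz))

end NearestPoints

/-! ### Crosscuts, chord and cochord integrals -/

/-- The segment from `p` to `q` as a curve on `[0, 1]`. -/
noncomputable def segmentCurve (p q : ℂ) (u : ℝ) : ℂ := p + u * (q - p)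

theorem isC1Curve_segmentCurve (p q : ℂ) : IsC1Curve (segmentCurve p q) fun _ => q - p where
  deriv t := by
    have h := ((Complex.ofRealCLM.hasDerivAt (x := t)).mul_const (q - p)).const_add p
    simp only [one_mul, Complex.ofRealCLM_apply, Complex.ofReal_one] at h
    exact h
  cont := continuous_const

theorem image_segmentCurve (p q : ℂ) : segmentCurve p q '' Icc 0 1 = segment ℝ p q := by
  rw [segment_eq_image']
  refine image_congr fun u _ => ?_
  simp [segmentCurve]

/-- The integral of `dw / (w - z)` along the segment from `p` to `q`. -/
noncomputable def segmentIntegral (p q z : ℂ) : ℂ :=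
  indexIntegral (segmentCurve p q) (fun _ => q - p) 0 1 z

theorem continuousAt_segmentIntegral {p q z : ℂ} (hz : z ∉ segment ℝ p q) :
    ContinuousAt (segmentIntegral p q) z :=
  (isC1Curve_segmentCurve p q).continuousAt_indexIntegral zero_le_one
    (by rwa [image_segmentCurve])

theorem exp_segmentIntegral {p q z : ℂ} (hz : z ∉ segment ℝ p q) :
    Complex.exp (segmentIntegral p q z) = (q - z) / (p - z) := by
  have := (isC1Curve_segmentCurve p q).exp_indexIntegral zero_le_one (z := z) fun u hu h =>
    hz (by rw [← image_segmentCurve]; exact ⟨u, hu, h⟩)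
  rw [segmentIntegral, this]
  simp [segmentCurve]

namespace IsC1Curve

/-- The index integral of the closed curve that runs along `f` from `f s` to `f t` and returns
along the broken line through `c`. -/
noncomputable def chordIntegral (f f' : ℝ → ℂ) (s t : ℝ) (c z : ℂ) : ℂ :=
  indexIntegral f f' s t z + segmentIntegral (f t) c z + segmentIntegral c (f s) z

variable {f f' : ℝ → ℂ} {s t : ℝ} {c z : ℂ}

theorem continuousAt_chordIntegral (hf : IsC1Curve f f') (hst : s ≤ t) (h1 : z ∉ f '' Icc s t)
    (h2 : z ∉ segment ℝ c (f t)) (h3 : z ∉ segment ℝ c (f s)) :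
    ContinuousAt (chordIntegral f f' s t c) z :=
  ((hf.continuousAt_indexIntegral hst h1).add
    (continuousAt_segmentIntegral (by rwa [segment_symm]))).add (continuousAt_segmentIntegral h3)

theorem chordIntegral_int (hf : IsC1Curve f f') (hst : s ≤ t) (h1 : z ∉ f '' Icc s t)
    (h2 : z ∉ segment ℝ c (f t)) (h3 : z ∉ segment ℝ c (f s)) :
    ∃ n : ℤ, chordIntegral f f' s t c z = n * (2 * Real.pi * Complex.I) := by
  refine Complex.exp_eq_one_iff.1 ?_
  have hs : f s - z ≠ 0 := sub_ne_zero.2 fun h => h1 ⟨s, ⟨le_rfl, hst⟩, h⟩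
  have ht : f t - z ≠ 0 := sub_ne_zero.2 fun h => h1 ⟨t, ⟨hst, le_rfl⟩, h⟩
  have hc : c - z ≠ 0 := sub_ne_zero.2 fun h => h3 (h ▸ left_mem_segment ℝ c (f s))
  rw [chordIntegral, Complex.exp_add, Complex.exp_add, exp_segmentIntegral h3,
    exp_segmentIntegral (by rwa [segment_symm]),
    hf.exp_indexIntegral hst fun u hu h => h1 ⟨u, hu, h⟩]
  field_simp

theorem chordIntegral_eq (hf : IsC1Curve f f') (hst : s ≤ t) {S : Set ℂ} (hS : IsPreconnected S)
    (h1 : ∀ z ∈ S, z ∉ f '' Icc s t) (h2 : ∀ z ∈ S, z ∉ segment ℝ c (f t))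
    (h3 : ∀ z ∈ S, z ∉ segment ℝ c (f s)) {x y : ℂ} (hx : x ∈ S) (hy : y ∈ S) :
    chordIntegral f f' s t c x = chordIntegral f f' s t c y :=
  hS.eq_of_two_pi_I_int
    (fun z hz => (hf.continuousAt_chordIntegral hst (h1 z hz) (h2 z hz)
      (h3 z hz)).continuousWithinAt)
    (fun z hz => hf.chordIntegral_int hst (h1 z hz) (h2 z hz) (h3 z hz)) hx hy

end IsC1Curve

namespace IsSimpleC1Loop

open IsC1Curve

/-- The index integral of the closed curve complementary to that of `chordIntegral`. -/
noncomputable def cochordIntegral (f f' : ℝ → ℂ) (a b s t : ℝ) (c z : ℂ) : ℂ :=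
  indexIntegral f f' a s z + indexIntegral f f' t b z
    - segmentIntegral (f t) c z - segmentIntegral c (f s) z

variable {f f' : ℝ → ℂ} {a b s t : ℝ} {c z : ℂ}

theorem chordIntegral_add_cochordIntegral (hf : IsSimpleC1Loop f f' a b) (has : a ≤ s)
    (hst : s ≤ t) (htb : t ≤ b) (hz : z ∉ f '' Icc a b) :
    chordIntegral f f' s t c z + cochordIntegral f f' a b s t c z = indexIntegral f f' a b z := by
  have hz' : ∀ u ∈ Icc a b, f u ≠ z := fun u hu h => hz ⟨u, hu, h⟩
  rw [← hf.indexIntegral_add (has.trans hst) htb hz', ← hf.indexIntegral_add has hst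
    fun u hu => hz' u ⟨hu.1, hu.2.trans htb⟩, chordIntegral, cochordIntegral]
  ring

/-- The arc from `f s` to `f t` does not occur in the cochord integral, which is therefore
continuous across it. -/
theorem continuousAt_cochordIntegral (hf : IsSimpleC1Loop f f' a b) (has : a ≤ s) (htb : t ≤ b)
    (h0 : z ∉ f '' Icc a s) (h1 : z ∉ f '' Icc t b)
    (h2 : z ∉ segment ℝ c (f t)) (h3 : z ∉ segment ℝ c (f s)) :
    ContinuousAt (cochordIntegral f f' a b s t c) z :=
  (((hf.continuousAt_indexIntegral has h0).add (hf.continuousAt_indexIntegral htb h1)).sub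
    (continuousAt_segmentIntegral (by rwa [segment_symm]))).sub (continuousAt_segmentIntegral h3)

theorem cochordIntegral_int (hf : IsSimpleC1Loop f f' a b) (has : a ≤ s) (htb : t ≤ b)
    (h0 : z ∉ f '' Icc a s) (h1 : z ∉ f '' Icc t b)
    (h2 : z ∉ segment ℝ c (f t)) (h3 : z ∉ segment ℝ c (f s)) :
    ∃ n : ℤ, cochordIntegral f f' a b s t c z = n * (2 * Real.pi * Complex.I) := by
  refine Complex.exp_eq_one_iff.1 ?_
  have ha : f a - z ≠ 0 := sub_ne_zero.2 fun h => h0 ⟨a, ⟨le_rfl, has⟩, h⟩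
  have hb : f b - z ≠ 0 := by rwa [← hf.closed]
  have hs : f s - z ≠ 0 := sub_ne_zero.2 fun h => h0 ⟨s, ⟨has, le_rfl⟩, h⟩
  have ht : f t - z ≠ 0 := sub_ne_zero.2 fun h => h1 ⟨t, ⟨le_rfl, htb⟩, h⟩
  have hc : c - z ≠ 0 := sub_ne_zero.2 fun h => h3 (h ▸ left_mem_segment ℝ c (f s))
  rw [cochordIntegral, Complex.exp_sub, Complex.exp_sub, Complex.exp_add, exp_segmentIntegral h3,
    exp_segmentIntegral (by rwa [segment_symm]),
    hf.exp_indexIntegral has fun u hu h => h0 ⟨u, hu, h⟩,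
    hf.exp_indexIntegral htb fun u hu h => h1 ⟨u, hu, h⟩, ← hf.closed]
  field_simp

theorem cochordIntegral_eq (hf : IsSimpleC1Loop f f' a b) (has : a ≤ s) (htb : t ≤ b) {S : Set ℂ}
    (hS : IsPreconnected S) (h0 : ∀ z ∈ S, z ∉ f '' Icc a s) (h1 : ∀ z ∈ S, z ∉ f '' Icc t b)
    (h2 : ∀ z ∈ S, z ∉ segment ℝ c (f t)) (h3 : ∀ z ∈ S, z ∉ segment ℝ c (f s)) {x y : ℂ}
    (hx : x ∈ S) (hy : y ∈ S) :
    cochordIntegral f f' a b s t c x = cochordIntegral f f' a b s t c y :=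
  hS.eq_of_two_pi_I_int
    (fun z hz => (hf.continuousAt_cochordIntegral has htb (h0 z hz) (h1 z hz) (h2 z hz)
      (h3 z hz)).continuousWithinAt)
    (fun z hz => hf.cochordIntegral_int has htb (h0 z hz) (h1 z hz) (h2 z hz) (h3 z hz)) hx hy

/-- `f s` is a point of the loop nearest to `c`. -/
def IsNearest (f : ℝ → ℂ) (a b s : ℝ) (c : ℂ) : Prop :=
  ∀ y ∈ f '' Icc a b, dist c (f s) ≤ dist c y

/-- If `f s` is nearest to `c` and `c` lies on the normal at `f s` on the side `σ`, the index
integral at `c` is the value on that side. -/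
theorem IsSideValue.eq_center (hf : IsSimpleC1Loop f f' a b) {σ ρ : ℝ} {k : ℂ} (hρ : 0 < ρ)
    (hσ : σ = 1 ∨ σ = -1) (hc : c = f s + f' s * (σ * ρ * Complex.I)) (hn : IsNearest f a b s c)
    (hk : IsSideValue f f' a b s σ k) : k = indexIntegral f f' a b c := by
  obtain ⟨y, hy, hy0⟩ := (hk.eventually.and (Ioo_mem_nhdsGT hρ)).exists
  rw [← hy]
  let g : ℝ → ℂ := fun y => f s + f' s * (σ * y * Complex.I)
  have hg : Continuous g := by fun_prop
  have hσ0 : (σ : ℂ) ≠ 0 := by rcases hσ with rfl | rfl <;> simp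
  -- The normal segment from `f s` to `c`, without the end `f s`, misses the loop because `f s` is
  -- nearest to `c`.
  refine hf.eq_of_isPreconnected (S := g '' Ioc 0 ρ) (isPreconnected_Ioc.image g hg.continuousOn)
    ?_ ⟨y, ⟨hy0.1, hy0.2.le⟩, rfl⟩ ⟨ρ, ⟨hρ, le_rfl⟩, hc.symm⟩
  rintro _ ⟨y, ⟨h1, h2⟩, rfl⟩
  refine notMem_of_mem_segment_of_nearest hn ?_ ?_
  · rw [segment_symm, segment_eq_image']
    refine ⟨y / ρ, ⟨by positivity, (div_le_one hρ).2 h2⟩, ?_⟩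
    have : (ρ : ℂ) ≠ 0 := by exact_mod_cast hρ.ne'
    simp only [g, hc, Complex.real_smul]; push_cast; field_simp; ring
  · intro h
    have : f' s * (σ * y * Complex.I) = 0 := by simpa [g] using h
    have hy0 : (y : ℂ) ≠ 0 := by exact_mod_cast h1.ne'
    simp [hf.ne s, hσ0, hy0] at this

/-- Coordinates of the region at a corner between the loop and a normal crosscut. -/
def cornerChart (ε : ℝ) : Set (ℝ × ℝ × ℝ) :=
  {p | 0 ≤ p.1 ∧ p.1 < ε ∧ 0 ≤ p.2.1 ∧ p.2.1 ≤ p.2.2 ∧ 0 < p.2.2 ∧ p.2.2 < ε ∧ 0 < p.1 + p.2.1}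

theorem convex_cornerChart (ε : ℝ) : Convex ℝ (cornerChart ε) := by
  rintro ⟨u, x, y⟩ ⟨h1, h2, h3, h4, h5, h6, h7⟩ ⟨u', x', y'⟩ ⟨h1', h2', h3', h4', h5', h6', h7'⟩
    α β hα hβ hαβ
  have h8 := convex_Ioi (0 : ℝ) h7 h7' hα hβ hαβ
  simp only [smul_eq_mul, mem_Ioi] at h8
  exact ⟨convex_Ici (0 : ℝ) h1 h1' hα hβ hαβ, convex_Iio ε h2 h2' hα hβ hαβ,
    convex_Ici (0 : ℝ) h3 h3' hα hβ hαβ,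
    add_le_add (mul_le_mul_of_nonneg_left h4 hα) (mul_le_mul_of_nonneg_left h4' hβ),
    convex_Ioi (0 : ℝ) h5 h5' hα hβ hαβ, convex_Iio ε h6 h6' hα hβ hαβ,
    by simp only [Prod.smul_mk, Prod.mk_add_mk, smul_eq_mul]; linarith⟩

/-- The two regions at a corner between the loop and a normal crosscut. -/
theorem exists_corner (hf : IsSimpleC1Loop f f' a b) (hs : s ∈ Ioo a b) (hst : s < t) (htb : t ≤ b)
    {σ ρ : ℝ} (hσ : σ = 1 ∨ σ = -1) (hc : c = f s + f' s * (σ * ρ * Complex.I))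
    (hct : IsNearest f a b t c) (hne : f t ≠ f s) :
    ∃ ε > 0, ∀ τ : ℝ, (τ = 1 ∨ τ = -1) → ∃ k : ℂ, ∀ v x y : ℝ, 0 ≤ v → v < ε → 0 ≤ x → x ≤ y →
      0 < y → y < ε → 0 < v + x →
      chordIntegral f f' s t c (f (s + τ * v) + f' s * (τ * x + σ * y * Complex.I)) = k := by
  obtain ⟨ε₁, hε₁, -, hcone⟩ := hf.exists_cone hs
  obtain ⟨ε₂, hε₂, hmono⟩ := hf.exists_strictMonoOn_re (hf.ne s)
  have hpq : f s ∉ segment ℝ c (f t) := fun h =>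
    notMem_of_mem_segment_of_nearest hct h hne.symm ⟨s, Ioo_subset_Icc_self hs, rfl⟩
  have hclosed : IsClosed (segment ℝ c (f t)) := by
    rw [← image_segmentCurve]; exact (isC1Curve_segmentCurve c (f t)).isClosed_image 0 1
  obtain ⟨η, hη, hball⟩ := Metric.isOpen_iff.1 hclosed.isOpen_compl _ hpq
  obtain ⟨ε₃, hε₃, hcont⟩ := Metric.continuous_iff.1 hf.continuous s (η / 2) (half_pos hη)
  have hD0 : 0 < ‖f' s‖ := norm_pos_iff.2 (hf.ne s)
  set D := f' s with hD
  set ε := min (min ε₁ ε₂) (min ε₃ (η / (4 * ‖D‖))) with hε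
  have hεpos : 0 < ε := by
    simp only [hε, lt_min_iff]
    exact ⟨⟨hε₁, hε₂⟩, hε₃, by positivity⟩
  have l1 : ε ≤ ε₁ := (min_le_left _ _).trans (min_le_left _ _)
  have l2 : ε ≤ ε₂ := (min_le_left _ _).trans (min_le_right _ _)
  have l3 : ε ≤ ε₃ := (min_le_right _ _).trans (min_le_left _ _)
  have l4 : ε ≤ η / (4 * ‖D‖) := (min_le_right _ _).trans (min_le_right _ _)
  have hσa : |σ| = 1 := by rcases hσ with rfl | rfl <;> simp
  refine ⟨ε, hεpos, fun τ hτ => ?_⟩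
  have hτa : |τ| = 1 := by rcases hτ with rfl | rfl <;> simp
  have hττ : τ * τ = 1 := by rcases hτ with rfl | rfl <;> simp
  let g : ℝ × ℝ × ℝ → ℂ := fun p =>
    f (s + τ * p.1) + D * (τ * p.2.1 + σ * p.2.2 * Complex.I)
  have hg : Continuous g := by
    have := hf.continuous
    fun_prop
  let C := cornerChart ε
  have hC : Convex ℝ C := convex_cornerChart ε
  have hI : ∀ v, 0 ≤ v → v < ε → ∀ δ, ε ≤ δ → s + τ * v ∈ Ioo (s - δ) (s + δ) := by
    intro v h1 h2 δ hδ
    have : |τ * v| < δ := by rw [abs_mul, hτa, one_mul, abs_of_nonneg h1]; linarith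
    rw [abs_lt] at this
    constructor <;> linarith [this.1, this.2]
  have hoff : ∀ p ∈ C, g p ∉ f '' Icc a b := by
    rintro ⟨v, x, y⟩ ⟨h1, h2, h3, h4, h5, h6, h7⟩
    have hy' : |σ * y| = y := by rw [abs_mul, hσa, one_mul, abs_of_pos h5]
    have hx' : |τ * x| = x := by rw [abs_mul, hτa, one_mul, abs_of_nonneg h3]
    have := hcone _ (hI v h1 h2 ε₁ l1) (τ * x) (σ * y) (by rwa [hy', hx'])
      (by rw [← abs_pos, hy']; exact h5) (by rw [hy']; exact h6.trans_le l1)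
    push_cast at this
    exact this
  have hoff2 : ∀ p ∈ C, g p ∉ segment ℝ c (f t) := by
    rintro ⟨v, x, y⟩ ⟨h1, h2, h3, h4, h5, h6, h7⟩
    refine hball ?_
    have i1 := hcont (s + τ * v) (by
      have := hI v h1 h2 ε₃ l3
      rw [Real.dist_eq, abs_lt]; constructor <;> linarith [this.1, this.2])
    have i2 : ‖D * (τ * x + σ * y * Complex.I)‖ < η / 2 := by
      rw [norm_mul]
      have j1 : ‖(τ * x + σ * y * Complex.I : ℂ)‖ ≤ x + y := by
        refine (norm_add_le _ _).trans ?_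
        simp [hτa, hσa, abs_of_nonneg h3, abs_of_pos h5]
      have j2 := h6.trans_le l4
      simp only at j2 h4
      rw [lt_div_iff₀ (by positivity)] at j2
      nlinarith
    rw [Metric.mem_ball, dist_eq_norm]
    rw [dist_eq_norm] at i1
    calc ‖f (s + τ * v) + D * (τ * x + σ * y * Complex.I) - f s‖
        = ‖(f (s + τ * v) - f s) + D * (τ * x + σ * y * Complex.I)‖ := by ring_nf
      _ ≤ _ := norm_add_le _ _
      _ < η := by linarith
  -- Points of the crosscut have tangential displacement `0` from `f s`. In the chart this
  -- displacement is strictly of sign `τ`, by monotone progress of the curve when `v > 0` and by `x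
  -- > 0` when `v = 0`.
  have hoff3 : ∀ p ∈ C, g p ∉ segment ℝ c (f s) := by
    rintro ⟨v, x, y⟩ ⟨h1, h2, h3, h4, h5, h6, h7⟩ hmem
    rw [segment_symm, segment_eq_image'] at hmem
    obtain ⟨l, -, hl⟩ := hmem
    have hre : (((f (s + τ * v) - f s) / D).re + τ * x) = 0 := by
      have e : (f (s + τ * v) - f s) / D + τ * x = (l * σ * ρ - σ * y : ℝ) * Complex.I := by
        simp only [g, hc, Complex.real_smul] at hl
        have hD1 : D ≠ 0 := hf.ne s
        rw [div_add' _ _ _ hD1, div_eq_iff hD1]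
        push_cast
        linear_combination -hl
      have := congrArg Complex.re e
      simpa using this
    simp only at h1 h2 h3 h7
    have hv : 0 < v → 0 < τ * ((f (s + τ * v) - f s) / D).re := by
      intro hv
      have hmem := Ioo_subset_Icc_self (hI v h1 h2 ε₂ l2)
      have hss : s ∈ Icc (s - ε₂) (s + ε₂) := ⟨by linarith, by linarith⟩
      rcases hτ with rfl | rfl
      · have := hmono hss hmem (by linarith)
        simpa using this
      · have := hmono hmem hss (by linarith)
        simpa using this
    have hz : τ * ((f (s + τ * v) - f s) / D).re + x = 0 := by
      linear_combination τ * hre - x * hττ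
    rcases h1.eq_or_lt with rfl | h1
    · simp at hz; linarith
    · linarith [hv h1]
  refine ⟨chordIntegral f f' s t c (g (0, ε / 2, ε / 2)), fun v x y h1 h2 h3 h4 h5 h6 h7 => ?_⟩
  have hsub : Icc s t ⊆ Icc a b := Icc_subset_Icc hs.1.le htb
  refine hf.chordIntegral_eq hst.le (S := g '' C) (hC.isPreconnected.image g hg.continuousOn)
    ?_ ?_ ?_ ⟨(v, x, y), ⟨h1, h2, h3, h4, h5, h6, h7⟩, rfl⟩
    ⟨(0, ε / 2, ε / 2), ⟨le_rfl, hεpos, ?_, le_rfl, ?_, ?_, ?_⟩, rfl⟩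
  · rintro _ ⟨p, hp, rfl⟩ h; exact hoff p hp (image_mono hsub h)
  · rintro _ ⟨p, hp, rfl⟩; exact hoff2 p hp
  · rintro _ ⟨p, hp, rfl⟩; exact hoff3 p hp
  all_goals simp only
  all_goals linarith

/-- The two pieces cut off by a crosscut have index integrals which, near the respective arcs of
the loop, add up to zero. -/
theorem exists_chordIntegral_add_eq_zero (hf : IsSimpleC1Loop f f' a b) (hs : s ∈ Ioo a b)
    (hst : s < t) (htb : t ≤ b) {σ ρ : ℝ} (hσ : σ = 1 ∨ σ = -1) (hρ : 0 < ρ)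
    (hc : c = f s + f' s * (σ * ρ * Complex.I))
    (hcs : IsNearest f a b s c) (hct : IsNearest f a b t c)
    (hw : indexIntegral f f' a b c ≠ 0) :
    ∃ u ∈ Ioo a s, ∃ v ∈ Ioo s t,
      chordIntegral f f' s t c (f u) + cochordIntegral f f' a b s t c (f v) = 0 := by
  have hne : f t ≠ f s := fun h => hst.ne' (hf.eq_of_eq hs ⟨hs.1.le.trans hst.le, htb⟩ h)
  obtain ⟨ε, hε, hcorner⟩ := hf.exists_corner hs hst htb hσ hc hct hne
  -- `k₁` and `k₂` are the chord integrals in the corners ahead of and behind `f s`, separated by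
  -- the crosscut; `k` below is the index on the side containing both.
  obtain ⟨k₁, hk₁⟩ := hcorner 1 (Or.inl rfl)
  obtain ⟨k₂, hk₂⟩ := hcorner (-1) (Or.inr rfl)
  have hσa : |σ| = 1 := by rcases hσ with rfl | rfl <;> simp
  have hσσ : (σ : ℂ) * σ = 1 := by rcases hσ with rfl | rfl <;> simp
  obtain ⟨k, hk⟩ := hf.exists_isSideValue hs hσa
  have hkc := hk.eq_center hf hρ hσ hc hcs
  have hkσ := hk.eq_of_ne_zero hf hs hσ (hkc ▸ hw)
  obtain ⟨ε', hε', -, hcone⟩ := hf.exists_cone hs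
  have hsub : Icc s t ⊆ Icc a b := Icc_subset_Icc hs.1.le htb
  have hD := hf.ne s
  have hρ0 : (ρ : ℂ) ≠ 0 := by exact_mod_cast hρ.ne'
  have hσ0 : (σ : ℂ) ≠ 0 := left_ne_zero_of_mul_eq_one hσσ
  -- jump across the crosscut
  have hjump : k₁ - k₂ = 2 * Real.pi * Complex.I * σ := by
    obtain ⟨y, hy0, hyε, hyε', hyρ⟩ : ∃ y > 0, y < ε ∧ y < ε' ∧ y < ρ := by
      obtain ⟨y, h1, h2⟩ := exists_between (lt_min hε (lt_min hε' hρ))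
      simp only [lt_min_iff] at h2
      exact ⟨y, h1, h2⟩
    set l := 1 - y / ρ with hl
    have hyρ' : y / ρ < 1 := (div_lt_one hρ).2 hyρ
    have hyρ0 : 0 < y / ρ := div_pos hy0 hρ
    have hcs' : f s - c ≠ 0 := by
      rw [hc, sub_add_cancel_left, neg_ne_zero]
      simp [hD, hσ0, hρ0]
    set z₀ := f s + f' s * (σ * y * Complex.I) with hz₀
    have hz₀' : segmentCurve c (f s) l = z₀ := by
      simp only [segmentCurve, hl, hz₀, hc]; push_cast; field_simp; ring
    have hzoff : z₀ ∉ f '' Icc a b := by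
      have := hcone s ⟨by linarith, by linarith⟩ 0 (σ * y)
        (abs_zero.trans_le (abs_nonneg _)) (by
          have := hy0.ne'
          rcases hσ with rfl | rfl <;> simpa)
        (by rw [abs_mul, hσa, one_mul, abs_of_pos hy0]; exact hyε')
      push_cast at this
      rwa [zero_add] at this
    have hzseg : z₀ ∈ segment ℝ c (f s) := by
      rw [← image_segmentCurve]; exact ⟨l, ⟨by linarith, by linarith⟩, hz₀'⟩
    have hzoff2 : z₀ ∉ segment ℝ c (f t) := by
      intro h
      -- equidistant points of two different radii
      have h1 := dist_add_dist_of_mem_segment hzseg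
      rw [segment_eq_image'] at h hzseg
      obtain ⟨l₁, hl₁, e₁⟩ := h
      have e₂ : c + (l : ℂ) * (f s - c) = z₀ := hz₀'
      simp only [Complex.real_smul] at e₁
      have hd : dist c (f s) = dist c (f t) :=
        le_antisymm (hcs _ ⟨t, ⟨hs.1.le.trans hst.le, htb⟩, rfl⟩)
          (hct _ ⟨s, Ioo_subset_Icc_self hs, rfl⟩)
      rw [dist_comm, dist_comm c, dist_eq_norm, dist_eq_norm] at hd
      have e₃ : (l : ℂ) * (f s - c) = l₁ * (f t - c) := by linear_combination e₂ - e₁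
      have e₄ := congrArg norm e₃
      have hl0 : 0 < l := by linarith
      rw [norm_mul, norm_mul, ← hd, Complex.norm_real, Complex.norm_real,
        Real.norm_of_nonneg hl0.le, Real.norm_of_nonneg hl₁.1] at e₄
      have e₅ : l = l₁ := mul_right_cancel₀ (norm_ne_zero_iff.2 hcs') e₄
      rw [← e₅] at e₃
      have hl0' : (l : ℂ) ≠ 0 := by exact_mod_cast hl0.ne'
      have := mul_left_cancel₀ hl0' e₃
      exact hne (by linear_combination -this)
    -- At `z₀` only the integral over the segment from `c` to `f s` is discontinuous, so the chord
    -- integral jumps by the jump of that segment.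
    have hj := (isC1Curve_segmentCurve c (f s)).tendsto_jump (s := 0) (t := 1) (m := l)
      (by linarith) (by linarith) hcs' (by
        intro u _ hu
        simp only [segmentCurve] at hu
        have := mul_right_cancel₀ hcs' (add_left_cancel hu)
        exact_mod_cast this)
    rw [hz₀'] at hj
    have hlim : ∀ τ : ℝ, Tendsto (fun h : ℝ => z₀ + (f s - c) * (τ * h * Complex.I)) (𝓝[>] 0)
        (𝓝 z₀) := by
      intro τ
      have : Continuous fun h : ℝ => z₀ + (f s - c) * (τ * h * Complex.I) := by fun_prop
      simpa using (this.tendsto 0).mono_left nhdsWithin_le_nhds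
    have hA := hf.continuousAt_indexIntegral hst.le fun h => hzoff (image_mono hsub h)
    have hB : ContinuousAt (segmentIntegral (f t) c) z₀ :=
      continuousAt_segmentIntegral (by rwa [segment_symm])
    have hAB := hA.add hB
    have hlimit := ((hAB.tendsto.comp (hlim 1)).sub (hAB.tendsto.comp (hlim (-1)))).add hj
    rw [sub_self, zero_add] at hlimit
    -- The left of the segment from `c` to `f s` is the corner ahead for `σ = 1` and the corner
    -- behind for `σ = -1`; hence the factor `σ`.
    have hval : ∀ᶠ h : ℝ in 𝓝[>] 0, (k₁ - k₂) * σ =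
        (((indexIntegral f f' s t + segmentIntegral (f t) c) ∘
          fun h : ℝ => z₀ + (f s - c) * ((1 : ℝ) * h * Complex.I)) h -
        ((indexIntegral f f' s t + segmentIntegral (f t) c) ∘
          fun h : ℝ => z₀ + (f s - c) * ((-1 : ℝ) * h * Complex.I)) h) +
        (indexIntegral (segmentCurve c (f s)) (fun _ => f s - c) 0 1
          (z₀ + (f s - c) * (h * Complex.I)) -
         indexIntegral (segmentCurve c (f s)) (fun _ => f s - c) 0 1
          (z₀ + (f s - c) * (-h * Complex.I))) := by
      filter_upwards [Ioo_mem_nhdsGT hyρ0] with h hh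
      have hx0 : 0 < ρ * h := mul_pos hρ hh.1
      have hxy : ρ * h ≤ y := by
        have := (lt_div_iff₀ hρ).1 hh.2; linarith
      have v1 := hk₁ 0 (ρ * h) y le_rfl hε hx0.le hxy hy0 hyε (by linarith)
      have v2 := hk₂ 0 (ρ * h) y le_rfl hε hx0.le hxy hy0 hyε (by linarith)
      simp only [mul_zero, add_zero] at v1 v2
      have p1 : ∀ τ : ℂ, z₀ + (f s - c) * (τ * h * Complex.I) =
          f s + f' s * (τ * σ * (ρ * h) + σ * y * Complex.I) := by
        intro τ
        rw [hz₀, hc]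
        linear_combination (-(f' s * σ * ρ * τ * h)) * Complex.I_sq
      have q1 := p1 1
      have q2 := p1 (-1)
      simp only [one_mul, neg_one_mul] at q1 q2
      simp only [Function.comp, Complex.ofReal_one, Complex.ofReal_neg, one_mul, neg_one_mul,
        Pi.add_apply, q1, q2]
      rcases hσ with rfl | rfl
      · rw [← v1, ← v2]
        simp only [chordIntegral, segmentIntegral]
        push_cast
        simp only [one_mul, mul_one, neg_mul]
        ring
      · rw [← v1, ← v2]
        simp only [chordIntegral, segmentIntegral]
        push_cast
        simp only [one_mul, mul_one, neg_mul, neg_neg, mul_neg]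
        ring
    have := tendsto_nhds_unique (tendsto_const_nhds.congr' hval) hlimit
    linear_combination σ * this - (k₁ - k₂) * hσσ
  -- values on the two arcs
  have hlim : ∀ u, Tendsto (fun y : ℝ => f u + f' s * (σ * y * Complex.I)) (𝓝[>] 0) (𝓝 (f u)) := by
    intro u
    have : Continuous fun y : ℝ => f u + f' s * (σ * y * Complex.I) := by fun_prop
    simpa using (this.tendsto 0).mono_left nhdsWithin_le_nhds
  have hseg : ∀ u ∈ Ioo a b, u ≠ s → u ≠ t →
      f u ∉ segment ℝ c (f t) ∧ f u ∉ segment ℝ c (f s) := by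
    intro u hu hus hut
    have hu' := Ioo_subset_Icc_self hu
    refine ⟨fun h => notMem_of_mem_segment_of_nearest hct h ?_ ⟨u, hu', rfl⟩,
      fun h => notMem_of_mem_segment_of_nearest hcs h ?_ ⟨u, hu', rfl⟩⟩
    · intro h; exact hut (hf.eq_of_eq hu ⟨hs.1.le.trans hst.le, htb⟩ h.symm).symm
    · intro h; exact hus (hf.eq_of_eq hs hu' h)
  obtain ⟨ε'', hε'', hside⟩ := hk
  obtain ⟨d, hd0, hdε, hda, hdt, hdε'', hdε'⟩ : ∃ d > 0, d < ε ∧ d < s - a ∧ d < t - s ∧ d < ε'' ∧ d < ε' := by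
    obtain ⟨y, h1, h2⟩ := exists_between (lt_min (lt_min hε (lt_min hε'' hε'))
      (lt_min (sub_pos.2 hs.1) (sub_pos.2 hst)))
    simp only [lt_min_iff] at h2
    exact ⟨y, h1, h2.1.1, h2.2.1, h2.2.2, h2.1.2.1, h2.1.2.2⟩
  refine ⟨s - d, ⟨by linarith, by linarith⟩, s + d, ⟨by linarith, by linarith⟩, ?_⟩
  have hu : s - d ∈ Ioo a b := ⟨by linarith, by linarith [hs.2]⟩
  have hv : s + d ∈ Ioo a b := ⟨by linarith [hs.1], by linarith⟩
  have w1 : chordIntegral f f' s t c (f (s - d)) = k₂ := by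
    have hcont := hf.continuousAt_chordIntegral (c := c) hst.le (z := f (s - d)) (by
      rintro ⟨u, h, e⟩
      have := hf.eq_of_eq hu (hsub h) e
      linarith [h.1]) (hseg _ hu (by linarith) (by linarith)).1 (hseg _ hu (by linarith) (by linarith)).2
    refine tendsto_nhds_unique (hcont.tendsto.comp (hlim (s - d))) (tendsto_const_nhds.congr' ?_)
    filter_upwards [Ioo_mem_nhdsGT hε] with y hy
    have := hk₂ d 0 y hd0.le hdε le_rfl hy.1.le hy.1 hy.2 (by linarith)
    rw [← this]
    simp [sub_eq_add_neg]
  -- Beside the arc, on the side `σ`, the index is `k` and the chord integral is `k₁`. The cochord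
  -- integral is their difference, and being continuous it keeps this value on the arc.
  have w2 : cochordIntegral f f' a b s t c (f (s + d)) = k - k₁ := by
    have hcont := hf.continuousAt_cochordIntegral (c := c) hs.1.le htb (z := f (s + d)) (by
      rintro ⟨u, h, e⟩
      have := hf.eq_of_eq hv ⟨h.1, h.2.trans hs.2.le⟩ e
      linarith [h.2]) (by
      rintro ⟨u, h, e⟩
      have := hf.eq_of_eq hv ⟨hs.1.le.trans (hst.le.trans h.1), h.2⟩ e
      linarith [h.1]) (hseg _ hv (by linarith) (by linarith)).1 (hseg _ hv (by linarith) (by linarith)).2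
    refine tendsto_nhds_unique (hcont.tendsto.comp (hlim (s + d))) (tendsto_const_nhds.congr' ?_)
    have hoff : ∀ᶠ y : ℝ in 𝓝[>] 0, f (s + d) + f' s * (σ * y * Complex.I) ∉ f '' Icc a b := by
      filter_upwards [Ioo_mem_nhdsGT hε'] with y hy
      have hy' : |σ * y| = y := by rw [abs_mul, hσa, one_mul, abs_of_pos hy.1]
      have := hcone (s + d) ⟨by linarith, by linarith⟩ 0 (σ * y)
        (abs_zero.trans_le (abs_nonneg _))
        (by rw [← abs_pos, hy']; exact hy.1) (by rw [hy']; exact hy.2)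
      push_cast at this
      rwa [zero_add] at this
    filter_upwards [Ioo_mem_nhdsGT hε, Ioo_mem_nhdsGT hε'', hoff] with y hy hy' hyo
    have h1 := hk₁ d 0 y hd0.le hdε le_rfl hy.1.le hy.1 hy.2 (by linarith)
    have h2 := hside (s + d) ⟨by linarith, by linarith⟩ 0 y (by simpa using hy.1.le) hy'.1 hy'.2
    have h3 := hf.chordIntegral_add_cochordIntegral (c := c) hs.1.le hst.le htb hyo
    simp only [one_mul, Complex.ofReal_one, Complex.ofReal_zero, zero_add, mul_zero] at h1 h2
    simp only [Function.comp]
    rw [h1, h2] at h3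
    linear_combination -h3
  rw [w1, w2, hkσ]
  linear_combination -hjump

end IsSimpleC1Loop

/-! ### Separation of contacts by a crosscut -/

namespace IsSimpleC1Loop

open IsC1Curve

variable {f f' : ℝ → ℂ} {a b s t : ℝ} {c z : ℂ}

/-- The complementary arc is connected, through the base if `t < b`, and it misses the crosscut
because radii meet the loop only at their feet. -/
theorem chordIntegral_arc_eq (hf : IsSimpleC1Loop f f' a b) (hs : s ∈ Ioo a b)
    (hst : s < t) (htb : t ≤ b) (hcs : IsNearest f a b s c) (hct : IsNearest f a b t c)
    {u n : ℝ} (hu : u ∈ Ioo a s) (hn : n ∈ Icc a b) (hnot : f n ∉ f '' Icc s t) :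
    chordIntegral f f' s t c (f n) = chordIntegral f f' s t c (f u) := by
  let N : Set ℝ := {v ∈ Icc a b | f v ∉ f '' Icc s t}
  have hsub : Icc s t ⊆ Icc a b := Icc_subset_Icc hs.1.le htb
  -- the complementary arc is connected
  obtain ⟨S, hS, hSN, hnS, huS⟩ : ∃ S : Set ℂ, IsPreconnected S ∧ S ⊆ f '' N ∧ f n ∈ S ∧ f u ∈ S := by
    have hIoo : Ioo a s ⊆ N := by
      intro v hv
      have hv' : v ∈ Ioo a b := ⟨hv.1, hv.2.trans hs.2⟩
      refine ⟨Ioo_subset_Icc_self hv', ?_⟩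
      rintro ⟨w, hw, e⟩
      have := hf.eq_of_eq hv' (hsub hw) e
      linarith [hw.1, hv.2]
    -- For `t = b` the base belongs to the arc from `f s` to `f t`, and the complementary arc is `f
    -- '' Ioo a s` alone.
    by_cases htb' : t = b
    · have hna : n ≠ a := by
        rintro rfl
        exact hnot ⟨t, ⟨hst.le, le_rfl⟩, by rw [htb', hf.closed]⟩
      have hns : n < s := by
        by_contra! h
        exact hnot ⟨n, ⟨h, htb' ▸ hn.2⟩, rfl⟩
      exact ⟨f '' Ioo a s, isPreconnected_Ioo.image f hf.continuous.continuousOn,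
        image_mono hIoo, ⟨n, ⟨lt_of_le_of_ne hn.1 hna.symm, hns⟩, rfl⟩, ⟨u, hu, rfl⟩⟩
    · have htb'' : t < b := lt_of_le_of_ne htb htb'
      have haN : f a ∉ f '' Icc s t := by
        rintro ⟨w, hw, e⟩
        have hw' : w ∈ Ioo a b := ⟨hs.1.trans_le hw.1, hw.2.trans_lt htb''⟩
        exact hw'.1.ne (hf.eq_of_eq hw' ⟨le_rfl, hf.lt.le⟩ e.symm)
      refine ⟨f '' Ico a s ∪ f '' Ioc t b, ?_, ?_, ?_, Or.inl ⟨u, ⟨hu.1.le, hu.2⟩, rfl⟩⟩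
      · exact IsPreconnected.union (f a) ⟨a, ⟨le_rfl, hs.1⟩, rfl⟩
          ⟨b, ⟨htb'', le_rfl⟩, hf.closed.symm⟩
          (isPreconnected_Ico.image f hf.continuous.continuousOn)
          (isPreconnected_Ioc.image f hf.continuous.continuousOn)
      · rintro _ (⟨v, hv, rfl⟩ | ⟨v, hv, rfl⟩)
        · rcases hv.1.eq_or_lt with rfl | hav
          · exact ⟨a, ⟨⟨le_rfl, hf.lt.le⟩, haN⟩, rfl⟩
          · exact ⟨v, hIoo ⟨hav, hv.2⟩, rfl⟩
        · refine ⟨v, ⟨⟨hs.1.le.trans (hst.le.trans hv.1.le), hv.2⟩, ?_⟩, rfl⟩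
          rcases hv.2.eq_or_lt with rfl | hvb
          · rwa [← hf.closed]
          · rintro ⟨w, hw, e⟩
            have := hf.eq_of_eq ⟨hs.1.trans (hst.trans hv.1), hvb⟩ (hsub hw) e
            linarith [hw.2, hv.1]
      · rcases lt_or_ge n s with h | h
        · exact Or.inl ⟨n, ⟨hn.1, h⟩, rfl⟩
        · refine Or.inr ⟨n, ⟨?_, hn.2⟩, rfl⟩
          by_contra! h'
          exact hnot ⟨n, ⟨h, h'⟩, rfl⟩
  refine hf.chordIntegral_eq hst.le hS ?_ ?_ ?_ hnS huS
  · intro z hz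
    obtain ⟨v, hv, rfl⟩ := hSN hz
    exact hv.2
  · intro z hz hmem
    obtain ⟨v, hv, rfl⟩ := hSN hz
    exact notMem_of_mem_segment_of_nearest hct hmem
      (fun h => hv.2 ⟨t, ⟨hst.le, le_rfl⟩, h.symm⟩) ⟨v, hv.1, rfl⟩
  · intro z hz hmem
    obtain ⟨v, hv, rfl⟩ := hSN hz
    exact notMem_of_mem_segment_of_nearest hcs hmem
      (fun h => hv.2 ⟨s, ⟨le_rfl, hst.le⟩, h.symm⟩) ⟨v, hv.1, rfl⟩

theorem cochordIntegral_arc_eq (hf : IsSimpleC1Loop f f' a b) (hs : s ∈ Ioo a b)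
    (htb : t ≤ b) (hcs : IsNearest f a b s c) (hct : IsNearest f a b t c)
    {v m : ℝ} (hv : v ∈ Ioo s t) (hm : m ∈ Ioo s t) :
    cochordIntegral f f' a b s t c (f m) = cochordIntegral f f' a b s t c (f v) := by
  have hin : ∀ w ∈ Ioo s t, w ∈ Ioo a b := fun w hw => ⟨hs.1.trans hw.1, hw.2.trans_le htb⟩
  have hst : s < t := hv.1.trans hv.2
  refine hf.cochordIntegral_eq hs.1.le htb (S := f '' Ioo s t)
    (isPreconnected_Ioo.image f hf.continuous.continuousOn) ?_ ?_ ?_ ?_ ⟨m, hm, rfl⟩ ⟨v, hv, rfl⟩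
  · rintro _ ⟨w, hw, rfl⟩ ⟨x, hx, e⟩
    have := hf.eq_of_eq (hin w hw) ⟨hx.1, hx.2.trans hs.2.le⟩ e
    linarith [hw.1, hx.2]
  · rintro _ ⟨w, hw, rfl⟩ ⟨x, hx, e⟩
    have := hf.eq_of_eq (hin w hw) ⟨hs.1.le.trans (hst.le.trans hx.1), hx.2⟩ e
    linarith [hw.2, hx.1]
  · rintro _ ⟨w, hw, rfl⟩ hmem
    refine notMem_of_mem_segment_of_nearest hct hmem (fun h => ?_)
      ⟨w, Ioo_subset_Icc_self (hin w hw), rfl⟩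
    exact hw.2.ne' (hf.eq_of_eq (hin w hw) ⟨hs.1.le.trans hst.le, htb⟩ h.symm)
  · rintro _ ⟨w, hw, rfl⟩ hmem
    refine notMem_of_mem_segment_of_nearest hcs hmem (fun h => ?_)
      ⟨w, Ioo_subset_Icc_self (hin w hw), rfl⟩
    exact hw.1.ne (hf.eq_of_eq (hin w hw) (Ioo_subset_Icc_self hs) h.symm)

/-- A disc inside a loop that touches the loop between the feet `f s`, `f t` of a crosscut touches
it only there. -/
theorem mem_image_of_touch (hf : IsSimpleC1Loop f f' a b) (hs : s ∈ Ioo a b)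
    (hst : s < t) (htb : t ≤ b) {σ ρ : ℝ} (hσ : σ = 1 ∨ σ = -1) (hρ : 0 < ρ)
    (hc : c = f s + f' s * (σ * ρ * Complex.I))
    (hcs : IsNearest f a b s c) (hct : IsNearest f a b t c)
    (hw : indexIntegral f f' a b c ≠ 0) {m n : ℝ} {c' : ℂ} (hm : m ∈ Ioo s t) (hn : n ∈ Icc a b)
    (hcm : IsNearest f a b m c') (hcn : IsNearest f a b n c') (hc' : c' ∉ f '' Icc a b)
    (hw' : indexIntegral f f' a b c' ≠ 0) (hcc : c ≠ c') : f n ∈ f '' Icc s t := by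
  by_contra hnot
  have hmI : m ∈ Ioo a b := ⟨hs.1.trans hm.1, hm.2.trans_le htb⟩
  have hsI := Ioo_subset_Icc_self hs
  have hmI' := Ioo_subset_Icc_self hmI
  have htI : t ∈ Icc a b := ⟨hs.1.le.trans hst.le, htb⟩
  obtain ⟨u, hu, v, hv, huv⟩ :=
    hf.exists_chordIntegral_add_eq_zero hs hst htb hσ hρ hc hcs hct hw
  rw [← hf.chordIntegral_arc_eq hs hst htb hcs hct hu hn hnot,
    ← hf.cochordIntegral_arc_eq hs htb hcs hct hv hm] at huv
  have hms : f m ≠ f s := fun h => hm.1.ne (hf.eq_of_eq hmI hsI h.symm)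
  have hmt : f m ≠ f t := fun h => hm.2.ne' (hf.eq_of_eq hmI htI h.symm)
  have hns : f n ≠ f s := fun h => hnot ⟨s, ⟨le_rfl, hst.le⟩, h.symm⟩
  have hnt : f n ≠ f t := fun h => hnot ⟨t, ⟨hst.le, le_rfl⟩, h.symm⟩
  have hdis : ∀ {x y : ℝ}, x ∈ Icc a b → y ∈ Icc a b → IsNearest f a b x c → IsNearest f a b y c' →
      f y ≠ f x → ∀ z ∈ segment ℝ c' (f y), z ∉ segment ℝ c (f x) :=
    fun hx hy h1 h2 hne z hz hz' => Set.disjoint_left.1 (disjoint_segment_of_nearest (mem_image_of_mem f hx)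
      (mem_image_of_mem f hy) h1 h2 hcc hne.symm) hz' hz
  -- The radii of the second disc transport the cochord integral from `f m`, and the chord integral
  -- from `f n`, to the center `c'`.
  have e1 : cochordIntegral f f' a b s t c c' = cochordIntegral f f' a b s t c (f m) := by
    refine hf.cochordIntegral_eq hs.1.le htb (S := segment ℝ c' (f m))
      (convex_segment _ _).isPreconnected ?_ ?_ (hdis htI hmI' hct hcm hmt)
      (hdis hsI hmI' hcs hcm hms) (left_mem_segment _ _ _) (right_mem_segment _ _ _)
    · rintro z hz ⟨x, hx, e⟩
      by_cases hzm : z = f m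
      · have := hf.eq_of_eq hmI ⟨hx.1, hx.2.trans hs.2.le⟩ (e.trans hzm)
        linarith [hm.1, hx.2]
      · exact notMem_of_mem_segment_of_nearest hcm hz hzm ⟨x, ⟨hx.1, hx.2.trans hs.2.le⟩, e⟩
    · rintro z hz ⟨x, hx, e⟩
      by_cases hzm : z = f m
      · have := hf.eq_of_eq hmI ⟨htI.1.trans hx.1, hx.2⟩ (e.trans hzm)
        linarith [hm.2, hx.1]
      · exact notMem_of_mem_segment_of_nearest hcm hz hzm ⟨x, ⟨htI.1.trans hx.1, hx.2⟩, e⟩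
  have e2 : chordIntegral f f' s t c c' = chordIntegral f f' s t c (f n) := by
    refine hf.chordIntegral_eq hst.le (S := segment ℝ c' (f n))
      (convex_segment _ _).isPreconnected ?_ (hdis htI hn hct hcn hnt)
      (hdis hsI hn hcs hcn hns) (left_mem_segment _ _ _) (right_mem_segment _ _ _)
    intro z hz h
    by_cases hzn : z = f n
    · exact hnot (hzn ▸ h)
    · exact notMem_of_mem_segment_of_nearest hcn hz hzn
        (image_mono (Icc_subset_Icc hs.1.le htb) h)
  refine hw' ?_
  rw [← hf.chordIntegral_add_cochordIntegral (c := c) hs.1.le hst.le htb hc', e1, e2, huv]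

/-- The same loop run backwards. -/
theorem reverse (hf : IsSimpleC1Loop f f' a b) :
    IsSimpleC1Loop (fun u => f (a + b - u)) (fun u => -f' (a + b - u)) a b where
  deriv u := by
    have h := (hf.deriv (a + b - u)).scomp u ((hasDerivAt_id u).const_sub (a + b))
    simpa [Function.comp_def] using h
  cont := (hf.cont.comp (by fun_prop)).neg
  lt := hf.lt
  ne u := neg_ne_zero.2 (hf.ne _)
  closed := by simpa using hf.closed.symm
  inj := by
    have hlt := hf.lt
    intro x hx y hy h
    have hx' : a + b - x ∈ Icc a b := ⟨by linarith [hx.2], by linarith [hx.1]⟩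
    have hy' : a + b - y ∈ Icc a b := ⟨by linarith [hy.2], by linarith [hy.1]⟩
    rcases hx.1.eq_or_lt with rfl | hxa
    · rcases hy.1.eq_or_lt with rfl | hya
      · rfl
      · have := hf.eq_of_eq ⟨by linarith [hy.2], by linarith⟩ hx' h
        linarith
    · have := hf.eq_of_eq ⟨by linarith [hx.2], by linarith⟩ hy' h.symm
      linarith

theorem reverse_image (f : ℝ → ℂ) (a b s t : ℝ) :
    (fun u => f (a + b - u)) '' Icc s t = f '' Icc (a + b - t) (a + b - s) := by
  rw [← image_image f (fun u => a + b - u)]; simp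

theorem reverse_indexIntegral (f f' : ℝ → ℂ) (a b : ℝ) (z : ℂ) :
    indexIntegral (fun u => f (a + b - u)) (fun u => -f' (a + b - u)) a b z =
      -indexIntegral f f' a b z := by
  have h := intervalIntegral.integral_comp_sub_left (a := a) (b := b)
    (fun u => -(f' u / (f u - z))) (a + b)
  simp only [add_sub_cancel_right, add_sub_cancel_left, intervalIntegral.integral_neg] at h
  simp only [indexIntegral, neg_div, intervalIntegral.integral_neg]
  exact h

theorem IsNearest.reverse (h : IsNearest f a b s c) :
    IsNearest (fun u => f (a + b - u)) a b (a + b - s) c := by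
  intro y hy
  rw [reverse_image] at hy
  simp only [add_sub_cancel_right, add_sub_cancel_left, sub_sub_cancel] at hy ⊢
  exact h y hy

/-- The case of `mem_image_of_touch` with the normal foot at the end of the arc. -/
theorem mem_image_of_touch' (hf : IsSimpleC1Loop f f' a b) (hs : s ∈ Ioo a b)
    (hst : t < s) (htb : a ≤ t) {σ ρ : ℝ} (hσ : σ = 1 ∨ σ = -1) (hρ : 0 < ρ)
    (hc : c = f s + f' s * (σ * ρ * Complex.I))
    (hcs : IsNearest f a b s c) (hct : IsNearest f a b t c)
    (hw : indexIntegral f f' a b c ≠ 0) {m n : ℝ} {c' : ℂ} (hm : m ∈ Ioo t s) (hn : n ∈ Icc a b)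
    (hcm : IsNearest f a b m c') (hcn : IsNearest f a b n c') (hc' : c' ∉ f '' Icc a b)
    (hw' : indexIntegral f f' a b c' ≠ 0) (hcc : c ≠ c') : f n ∈ f '' Icc t s := by
  -- Reversal negates the velocity and so exchanges the sides: `σ` becomes `-σ`.
  have h := hf.reverse.mem_image_of_touch (s := a + b - s) (t := a + b - t) (σ := -σ) (ρ := ρ)
    (c := c) (c' := c') (m := a + b - m) (n := a + b - n)
    ⟨by linarith [hs.2], by linarith [hs.1]⟩ (by linarith) (by linarith)
    (by rcases hσ with rfl | rfl <;> simp) hρ (by rw [hc]; simp) hcs.reverse hct.reverse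
    (by rwa [reverse_indexIntegral, neg_ne_zero]) ⟨by linarith [hm.2], by linarith [hm.1]⟩
    ⟨by linarith [hn.2], by linarith [hn.1]⟩ hcm.reverse hcn.reverse
    (by rw [reverse_image]; simpa using hc') (by rwa [reverse_indexIntegral, neg_ne_zero]) hcc
  rw [reverse_image] at h
  simpa using h

end IsSimpleC1Loop

/-! ### Comparison with tangent unit circles -/

section CurvatureComparison

theorem nonneg_of_hasDerivAt_nonneg {h h' : ℝ → ℝ} {x : ℝ} (hd : ∀ u, HasDerivAt h (h' u) u)
    (h0 : h 0 = 0) (hn : ∀ u ∈ Icc 0 x, 0 ≤ h' u) : ∀ u ∈ Icc 0 x, 0 ≤ h u := by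
  intro u hu
  have hmono : MonotoneOn h (Icc 0 x) := by
    refine monotoneOn_of_deriv_nonneg (convex_Icc _ _)
      (fun u _ => (hd u).continuousAt.continuousWithinAt)
      (fun u _ => (hd u).differentiableAt.differentiableWithinAt) fun u hu => ?_
    rw [(hd u).deriv]
    exact hn u (interior_subset hu)
  rw [← h0]
  exact hmono ⟨le_rfl, hu.1.trans hu.2⟩ hu hu.1

/-- A curve of curvature at most `1` stays outside its tangent unit discs for length `π / 2`. -/
theorem one_le_norm_sub_of_curvature_le {g : ℝ → ℂ} {V θ K : ℝ → ℝ} {x σ : ℝ} (hx : 0 ≤ x)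
    (hσ : |σ| = 1) (hg : ∀ u, HasDerivAt g (V u * Complex.exp (θ u * Complex.I)) u)
    (hθ : ∀ u, HasDerivAt θ (K u) u) (hV : Continuous V) (hKV : ∀ u, |K u| ≤ V u)
    (hg0 : g 0 = 0) (hθ0 : θ 0 = 0) (hlen : ∫ u in (0)..x, V u ≤ Real.pi / 2) :
    1 ≤ ‖g x - σ * Complex.I‖ := by
  set L : ℝ → ℝ := fun u => ∫ v in (0)..u, V v with hL
  have hLd : ∀ u, HasDerivAt L (V u) u := fun u => hV.integral_hasStrictDerivAt 0 u |>.hasDerivAt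
  have hL0 : L 0 = 0 := intervalIntegral.integral_same
  have hV0 : ∀ u, 0 ≤ V u := fun u => (abs_nonneg _).trans (hKV u)
  have hLnn : ∀ u ∈ Icc 0 x, 0 ≤ L u := nonneg_of_hasDerivAt_nonneg hLd hL0 fun u _ => hV0 u
  have hLle : ∀ u ∈ Icc 0 x, L u ≤ Real.pi / 2 := by
    intro u hu
    refine le_trans ?_ hlen
    have hm : Monotone L := monotone_of_deriv_nonneg (fun u => (hLd u).differentiableAt)
      fun u => by rw [(hLd u).deriv]; exact hV0 u
    exact hm hu.2
  have hθL : ∀ u ∈ Icc 0 x, |θ u| ≤ L u := by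
    intro u hu
    have h1 := nonneg_of_hasDerivAt_nonneg (x := x) (fun u => (hLd u).sub (hθ u)) (by simp [hL0, hθ0])
      (fun u _ => by linarith [(abs_le.1 (hKV u)).2]) u hu
    have h2 := nonneg_of_hasDerivAt_nonneg (x := x) (fun u => (hLd u).add (hθ u)) (by simp [hL0, hθ0])
      (fun u _ => by linarith [(abs_le.1 (hKV u)).1]) u hu
    simp only [Pi.sub_apply, Pi.add_apply] at h1 h2
    exact abs_le.2 ⟨by linarith, by linarith⟩
  have hre : ∀ u, HasDerivAt (fun u => (g u).re) (V u * Real.cos (θ u)) u := by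
    intro u
    have h := Complex.reCLM.hasFDerivAt.comp_hasDerivAt u (hg u)
    refine h.congr_deriv ?_
    simp [Complex.exp_ofReal_mul_I_re]
  have him : ∀ u, HasDerivAt (fun u => (g u).im) (V u * Real.sin (θ u)) u := by
    intro u
    have h := Complex.imCLM.hasFDerivAt.comp_hasDerivAt u (hg u)
    refine h.congr_deriv ?_
    simp [Complex.exp_ofReal_mul_I_im]
  have hxx : x ∈ Icc 0 x := ⟨hx, le_rfl⟩
  -- With `L` the arc length, `|θ| ≤ L ≤ π / 2` gives `sin L ≤ re g` and `σ * im g ≤ 1 - cos L` by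
  -- integration: the curve advances at least as far as the unit circle and bends at most as much.
  -- The squares then add up to at least `1`.
  have hX := nonneg_of_hasDerivAt_nonneg (x := x) (fun u => (hre u).sub (hLd u).sin)
    (by simp [hg0, hL0]) (fun u hu => by
      have h1 : Real.cos (L u) ≤ Real.cos (θ u) := by
        rw [← Real.cos_abs (θ u)]
        exact Real.cos_le_cos_of_nonneg_of_le_pi (abs_nonneg _)
          (by linarith [hLle u hu, Real.pi_pos]) (hθL u hu)
      nlinarith [hV0 u]) x hxx
  have hY := nonneg_of_hasDerivAt_nonneg (x := x)
    (fun u => ((hLd u).cos.const_sub 1).sub ((him u).const_mul σ))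
    (by simp [hg0, hL0]) (fun u hu => by
      have h1 : σ * Real.sin (θ u) ≤ Real.sin (L u) := by
        have h2 := hLle u hu
        have h3 := abs_le.1 (hθL u hu)
        have h4 : Real.sin (θ u) ≤ Real.sin (L u) :=
          Real.sin_le_sin_of_le_of_le_pi_div_two (by linarith) h2 h3.2
        have h5 : Real.sin (-L u) ≤ Real.sin (θ u) :=
          Real.sin_le_sin_of_le_of_le_pi_div_two (by linarith) (by linarith) h3.1
        rw [Real.sin_neg] at h5
        rcases abs_eq (zero_le_one' ℝ) |>.1 hσ with rfl | rfl <;> linarith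
      nlinarith [hV0 u]) x hxx
  simp only [Pi.sub_apply] at hX hY
  have hσ2 : σ ^ 2 = 1 := by rw [← sq_abs, hσ, one_pow]
  have hcos : 0 ≤ Real.cos (L x) :=
    Real.cos_nonneg_of_mem_Icc ⟨by linarith [hLnn x hxx, Real.pi_pos], hLle x hxx⟩
  have hsin : 0 ≤ Real.sin (L x) :=
    Real.sin_nonneg_of_nonneg_of_le_pi (hLnn x hxx) (by linarith [hLle x hxx, Real.pi_pos])
  have hsq := Real.sin_sq_add_cos_sq (L x)
  have hn : ‖g x - σ * Complex.I‖ ^ 2 = (g x).re ^ 2 + ((g x).im - σ) ^ 2 := by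
    rw [← Complex.normSq_eq_norm_sq, Complex.normSq_apply]; simp; ring
  have h1 : Real.sin (L x) ^ 2 ≤ (g x).re ^ 2 := pow_le_pow_left₀ hsin (by linarith) 2
  have h2 : Real.cos (L x) ^ 2 ≤ (1 - σ * (g x).im) ^ 2 := pow_le_pow_left₀ hcos (by linarith) 2
  have h3 : (1 - σ * (g x).im) ^ 2 = ((g x).im - σ) ^ 2 + (σ ^ 2 - 1) * ((g x).im ^ 2 - 1) := by ring
  rw [hσ2, sub_self, zero_mul, add_zero] at h3
  have h4 : 1 ≤ ‖g x - σ * Complex.I‖ ^ 2 := by rw [hn, ← h3]; linarith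
  nlinarith [norm_nonneg (g x - σ * Complex.I)]

end CurvatureComparison

namespace IsC1Curve

variable {f f' : ℝ → ℂ} {a b : ℝ}

/-- Nearby points of the curve lie outside the open unit discs tangent to it. -/
def IsLocallyOutside (f f' : ℝ → ℂ) (a b δ : ℝ) : Prop :=
  ∀ s ∈ Icc a b, ∀ t ∈ Icc a b, |t - s| ≤ δ → ∀ σ : ℝ, (σ = 1 ∨ σ = -1) →
    1 ≤ ‖f t - f s - f' s * (σ * ‖f' s‖⁻¹ * Complex.I)‖

/-- The speed is bounded on `[a, b]`, so short parameter intervals have arc length at most `π / 2`,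
uniformly in their position. -/
theorem exists_isLocallyOutside (hf : IsC1Curve f f') {V θ K : ℝ → ℝ} (hVpos : ∀ u, 0 < V u)
    (hf' : ∀ u, f' u = V u * Complex.exp (θ u * Complex.I)) (hV : Continuous V)
    (hθ : ∀ u, HasDerivAt θ (K u) u) (hKV : ∀ u, |K u| ≤ V u) :
    ∃ δ > 0, IsLocallyOutside f f' a b δ := by
  obtain ⟨M, hM⟩ := (isCompact_Icc (a := a) (b := b)).exists_bound_of_continuousOn hV.continuousOn
  have hpi := Real.pi_pos
  refine ⟨Real.pi / 2 / (|M| + 1), by positivity, fun s hs t ht hst σ hσ => ?_⟩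
  have hnorm : ‖f' s‖ = V s := by
    rw [hf', norm_mul, Complex.norm_exp_ofReal_mul_I, mul_one, Complex.norm_real,
      Real.norm_of_nonneg (hVpos s).le]
  have hVs : (V s : ℂ) ≠ 0 := by exact_mod_cast (hVpos s).ne'
  have hσa : |σ| = 1 := by rcases hσ with rfl | rfl <;> simp
  obtain ⟨τ, hτ, htτ⟩ : ∃ τ : ℝ, (τ = 1 ∨ τ = -1) ∧ t = s + τ * |t - s| := by
    rcases le_total s t with h | h
    · exact ⟨1, Or.inl rfl, by rw [abs_of_nonneg (sub_nonneg.2 h)]; ring⟩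
    · exact ⟨-1, Or.inr rfl, by rw [abs_of_nonpos (sub_nonpos.2 h)]; ring⟩
  have hττ : (τ : ℂ) * τ = 1 := by rcases hτ with rfl | rfl <;> simp
  have hτa : |τ| = 1 := by rcases hτ with rfl | rfl <;> simp
  set x := |t - s| with hx
  have haff : ∀ u, HasDerivAt (fun u => s + τ * u) τ u := fun u => by
    simpa using ((hasDerivAt_id u).const_mul τ).const_add s
  -- The curve is moved to start at `0` in direction `1`. Backward in time (`τ = -1`) this includes
  -- a half turn, which sends the disc on the side `σ` to the side `σ * τ`.
  have key := one_le_norm_sub_of_curvature_le (x := x) (σ := σ * τ) (V := fun u => V (s + τ * u))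
    (θ := fun u => θ (s + τ * u) - θ s) (K := fun u => K (s + τ * u) * τ)
    (g := fun u => τ * Complex.exp (-(θ s * Complex.I)) * (f (s + τ * u) - f s))
    (abs_nonneg _) (by rw [abs_mul, hσa, hτa, one_mul]) (fun u => ?_)
    (fun u => ((hθ (s + τ * u)).comp u (haff u)).sub_const _) (hV.comp (by fun_prop))
    (fun u => by rw [abs_mul, hτa, mul_one]; exact hKV _) (by simp) (by simp) ?_
  · refine key.trans_eq ?_
    rw [← htτ]
    have e : f t - f s - f' s * (σ * ‖f' s‖⁻¹ * Complex.I) =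
        τ * Complex.exp (θ s * Complex.I) * (τ * Complex.exp (-(θ s * Complex.I)) * (f t - f s)
          - ((σ * τ : ℝ) : ℂ) * Complex.I) := by
      have h1 : Complex.exp (θ s * Complex.I) * Complex.exp (-(θ s * Complex.I)) = 1 := by
        rw [← Complex.exp_add]; simp
      rw [hnorm, hf']
      push_cast
      have h2 : (V s : ℂ) * (V s : ℂ)⁻¹ = 1 := mul_inv_cancel₀ hVs
      linear_combination (-(f t - f s)) * Complex.exp (θ s * Complex.I) *
        Complex.exp (-(θ s * Complex.I)) * hττ - (f t - f s) * h1
        + Complex.exp (θ s * Complex.I) * σ * Complex.I * hττ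
        - Complex.exp (θ s * Complex.I) * σ * Complex.I * h2
    rw [e, norm_mul, norm_mul, Complex.norm_exp_ofReal_mul_I, Complex.norm_real, Real.norm_eq_abs,
      hτa, one_mul, one_mul]
  · have h := (((hf.deriv (s + τ * u)).scomp u (haff u)).sub_const (f s)).const_mul
      (τ * Complex.exp (-(θ s * Complex.I)))
    refine h.congr_deriv ?_
    rw [hf', Complex.real_smul]
    push_cast
    have h1 : Complex.exp (((θ (s + τ * u) : ℂ) - θ s) * Complex.I) =
        Complex.exp (-(θ s * Complex.I)) * Complex.exp (θ (s + τ * u) * Complex.I) := by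
      rw [← Complex.exp_add]; ring_nf
    rw [h1]
    linear_combination (Complex.exp (-(θ s * Complex.I)) * V (s + τ * u) *
      Complex.exp (θ (s + τ * u) * Complex.I)) * hττ
  · have hb : ‖∫ u in (0)..x, V (s + τ * u)‖ ≤ (|M| + 1) * |x - 0| := by
      refine intervalIntegral.norm_integral_le_of_norm_le_const fun u hu => ?_
      rw [uIoc_of_le (abs_nonneg _)] at hu
      refine (hM _ ?_).trans ((le_abs_self M).trans (by linarith))
      rcases hτ with rfl | rfl
      · exact ⟨by linarith [hs.1, hu.1], by linarith [hs.2, hu.2, ht.2]⟩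
      · exact ⟨by linarith [hs.1, hu.2, ht.1], by linarith [hs.2, hu.1]⟩
    refine (le_abs_self _).trans (hb.trans ?_)
    rw [sub_zero, abs_of_nonneg (abs_nonneg _)]
    calc (|M| + 1) * x ≤ (|M| + 1) * (Real.pi / 2 / (|M| + 1)) :=
          mul_le_mul_of_nonneg_left hst (by positivity)
      _ = Real.pi / 2 := by field_simp

end IsC1Curve

/-! ### Touching discs and the halving argument -/

/-- Squaring makes the condition linear in `R`: for positive `inner ℝ w N`, the reciprocal of the
largest admissible radius is `2 * inner ℝ w N / ‖w‖ ^ 2`. -/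
theorem le_norm_sub_smul_iff {E : Type*} [NormedAddCommGroup E] [InnerProductSpace ℝ E] {w N : E}
    {R : ℝ} (hR : 0 ≤ R) (hN : ‖N‖ = 1) :
    R ≤ ‖w - R • N‖ ↔ R * (2 * inner ℝ w N) ≤ ‖w‖ ^ 2 := by
  rw [← abs_of_nonneg hR, ← abs_of_nonneg (norm_nonneg (w - |R| • N)), ← sq_le_sq, abs_of_nonneg hR,
    norm_sub_sq_real, inner_smul_right, norm_smul, hN, mul_one, Real.norm_of_nonneg hR]
  constructor <;> intro h <;> linarith

theorem norm_sub_smul_eq_iff {E : Type*} [NormedAddCommGroup E] [InnerProductSpace ℝ E] {w N : E}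
    {R : ℝ} (hR : 0 ≤ R) (hN : ‖N‖ = 1) :
    ‖w - R • N‖ = R ↔ R * (2 * inner ℝ w N) = ‖w‖ ^ 2 := by
  rw [← sq_eq_sq₀ (norm_nonneg _) hR, norm_sub_sq_real, inner_smul_right, norm_smul, hN, mul_one,
    Real.norm_of_nonneg hR]
  constructor <;> intro h <;> linarith

namespace IsSimpleC1Loop

open IsC1Curve

variable {f f' : ℝ → ℂ} {a b s t : ℝ} {c z : ℂ}

/-- `c` is the center of a disc of radius less than `1` that is inscribed in the loop, is tangent
to the loop at the inner time `s`, and also touches it at another point `f t`. -/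
structure IsTouching (f f' : ℝ → ℂ) (a b s t : ℝ) (c : ℂ) : Prop where
  left_mem : s ∈ Ioo a b
  right_mem : t ∈ Icc a b
  ne : f t ≠ f s
  normal : ∃ σ R : ℝ, (σ = 1 ∨ σ = -1) ∧ 0 < R ∧ R < 1 ∧
    c = f s + f' s * (σ * (R / ‖f' s‖ : ℝ) * Complex.I)
  nearest_left : IsNearest f a b s c
  nearest_right : IsNearest f a b t c
  index_ne : indexIntegral f f' a b c ≠ 0

/-- The unit normal of the loop on the side `σ`. -/
noncomputable def sideNormal (f' : ℝ → ℂ) (s σ : ℝ) : ℂ := f' s * (σ * ‖f' s‖⁻¹ * Complex.I)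

theorem norm_sideNormal (hf : IsSimpleC1Loop f f' a b) (s : ℝ) {σ : ℝ} (hσ : σ = 1 ∨ σ = -1) :
    ‖sideNormal f' s σ‖ = 1 := by
  have hσa : |σ| = 1 := by rcases hσ with rfl | rfl <;> simp
  have := norm_pos_iff.2 (hf.ne s)
  simp [sideNormal, hσa, this.ne']

theorem add_smul_sideNormal (f f' : ℝ → ℂ) (s σ R : ℝ) :
    f s + R • sideNormal f' s σ = f s + f' s * (σ * (R / ‖f' s‖ : ℝ) * Complex.I) := by
  rw [sideNormal, Complex.real_smul]; push_cast; ring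

theorem dist_add_smul_sideNormal (f f' : ℝ → ℂ) (s σ R : ℝ) (w : ℂ) :
    dist (f s + R • sideNormal f' s σ) w = ‖w - f s - R • sideNormal f' s σ‖ := by
  rw [dist_comm, dist_eq_norm, sub_sub]

/-- A point other than `f s` on a tangent circle of radius `R < 1` lies in the open unit disc
tangent at `f s` on the same side, which nearby points of the curve avoid. -/
theorem IsTouching.lt_abs_sub (hf : IsSimpleC1Loop f f' a b) {δ : ℝ}
    (hδ : IsLocallyOutside f f' a b δ) (h : IsTouching f f' a b s t c) : δ < |t - s| := by
  by_contra! hle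
  obtain ⟨σ, R, hσ, hR0, hR1, hc⟩ := h.normal
  rw [← add_smul_sideNormal] at hc
  have hN := hf.norm_sideNormal s hσ
  have hs := Ioo_subset_Icc_self h.left_mem
  have h1 := hδ s hs t h.right_mem hle σ hσ
  have h2 : 1 ≤ ‖f t - f s - (1 : ℝ) • sideNormal f' s σ‖ := by simpa [sideNormal] using h1
  rw [le_norm_sub_smul_iff zero_le_one hN, one_mul] at h2
  have h3 : dist c (f t) = dist c (f s) :=
    le_antisymm (h.nearest_right _ ⟨s, hs, rfl⟩) (h.nearest_left _ ⟨t, h.right_mem, rfl⟩)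
  rw [hc, dist_add_smul_sideNormal, dist_add_smul_sideNormal, sub_self, zero_sub, norm_neg,
    norm_smul, hN, mul_one, Real.norm_of_nonneg hR0.le, norm_sub_smul_eq_iff hR0.le hN] at h3
  have h4 : 0 < ‖f t - f s‖ ^ 2 := pow_pos (norm_pos_iff.2 (sub_ne_zero.2 h.ne)) 2
  nlinarith

/-- Either some inscribed unit disc exists, or the maximal inscribed disc tangent to the loop at a
given point touches the loop elsewhere. -/
theorem exists_isTouching (hf : IsSimpleC1Loop f f' a b) {δ : ℝ} (hδ0 : 0 < δ)
    (hδ : IsLocallyOutside f f' a b δ)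
    (hno : ∀ c, indexIntegral f f' a b c ≠ 0 → ∃ y ∈ f '' Icc a b, dist c y < 1)
    {m : ℝ} (hm : m ∈ Ioo a b) : ∃ n c, IsTouching f f' a b m n c := by
  obtain ⟨σ, hσ, k, hk0, hk⟩ := hf.exists_sideValue_ne_zero hm
  have hm' := Ioo_subset_Icc_self hm
  have hD := norm_pos_iff.2 (hf.ne m)
  set N := sideNormal f' m σ with hNdef
  have hN : ‖N‖ = 1 := hf.norm_sideNormal m hσ
  have hdm : ∀ R : ℝ, 0 < R → dist (f m + R • N) (f m) = R := by
    intro R hR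
    rw [dist_add_smul_sideNormal, sub_self, zero_sub, norm_neg, norm_smul, hN, mul_one,
      Real.norm_of_nonneg hR.le]
  have hnear : ∀ R : ℝ, 0 < R →
      (∀ u ∈ Icc a b, R * (2 * inner ℝ (f u - f m) N) ≤ ‖f u - f m‖ ^ 2) →
      IsNearest f a b m (f m + R • N) ∧ indexIntegral f f' a b (f m + R • N) ≠ 0 := by
    intro R hR h
    have hn : IsNearest f a b m (f m + R • N) := by
      rintro _ ⟨u, hu, rfl⟩
      rw [hdm R hR, dist_add_smul_sideNormal, le_norm_sub_smul_iff hR.le hN]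
      exact h u hu
    refine ⟨hn, ?_⟩
    rwa [← hk.eq_center hf (div_pos hR hD) hσ (add_smul_sideNormal f f' m σ R) hn]
  have hlocal : ∀ u ∈ Icc a b, |u - m| ≤ δ → 2 * inner ℝ (f u - f m) N ≤ ‖f u - f m‖ ^ 2 := by
    intro u hu hum
    have h1 := hδ m hm' u hu hum σ hσ
    have h2 : 1 ≤ ‖f u - f m - (1 : ℝ) • N‖ := by simpa [hNdef, sideNormal] using h1
    rwa [le_norm_sub_smul_iff zero_le_one hN, one_mul] at h2
  have hcl : IsClosed {u : ℝ | δ ≤ |u - m|} := isClosed_le continuous_const (by fun_prop)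
  have hK : IsCompact {u ∈ Icc a b | δ ≤ |u - m|} := isCompact_Icc.inter_right hcl
  set K := {u ∈ Icc a b | δ ≤ |u - m|}
  have hψ : ∀ u ∈ K, 0 < ‖f u - f m‖ ^ 2 := by
    intro u hu
    refine pow_pos (norm_pos_iff.2 (sub_ne_zero.2 fun h => ?_)) 2
    have h1 := hu.2
    rw [hf.eq_of_eq hm hu.1 h, sub_self, abs_zero] at h1
    linarith
  by_cases hall : ∀ u ∈ K, 2 * inner ℝ (f u - f m) N ≤ ‖f u - f m‖ ^ 2
  · exfalso
    obtain ⟨h1, h2⟩ := hnear 1 one_pos fun u hu => by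
      rw [one_mul]
      rcases le_total δ |u - m| with h | h
      · exact hall u ⟨hu, h⟩
      · exact hlocal u hu h
    obtain ⟨y, hy, hy1⟩ := hno _ h2
    have h3 := h1 y hy
    rw [hdm 1 one_pos] at h3
    linarith
  · push Not at hall
    obtain ⟨u₀, hu₀, hlt⟩ := hall
    -- Where positive, the quotient is the curvature of the circle tangent at `f m` through `f u`.
    -- Its maximum `q > 1` over the times away from `m` gives the radius `q⁻¹` of the largest
    -- inscribed disc, and nearby times impose only radius at most `1`.
    obtain ⟨n, hn, hmax⟩ := hK.exists_isMaxOn ⟨u₀, hu₀⟩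
      (f := fun u => 2 * inner ℝ (f u - f m) N / ‖f u - f m‖ ^ 2) (by
        refine ContinuousOn.div (Continuous.continuousOn ?_) (Continuous.continuousOn ?_)
          fun u hu => (hψ u hu).ne'
        · have := hf.continuous; fun_prop
        · have := hf.continuous; fun_prop)
    set q := 2 * inner ℝ (f n - f m) N / ‖f n - f m‖ ^ 2 with hq
    have hq1 : 1 < q := ((one_lt_div (hψ u₀ hu₀)).2 hlt).trans_le (hmax hu₀)
    have hq0 : 0 < q := by linarith
    have hqn : 2 * inner ℝ (f n - f m) N = q * ‖f n - f m‖ ^ 2 := by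
      rw [hq, div_mul_cancel₀ _ (hψ n hn).ne']
    have hR : 0 < q⁻¹ := inv_pos.2 hq0
    obtain ⟨h1, h2⟩ := hnear q⁻¹ hR fun u hu => by
      rw [inv_mul_le_iff₀ hq0]
      rcases le_total δ |u - m| with h | h
      · exact (div_le_iff₀ (hψ u ⟨hu, h⟩)).1 (hmax ⟨hu, h⟩)
      · refine (hlocal u hu h).trans ?_
        nlinarith [sq_nonneg ‖f u - f m‖]
    have hdn : dist (f m + q⁻¹ • N) (f n) = q⁻¹ := by
      rw [dist_add_smul_sideNormal, norm_sub_smul_eq_iff hR.le hN, hqn, inv_mul_cancel_left₀ hq0.ne']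
    refine ⟨n, f m + q⁻¹ • N, hm, hn.1, fun h => ?_,
      ⟨σ, q⁻¹, hσ, hR, inv_lt_one_of_one_lt₀ hq1, add_smul_sideNormal f f' m σ _⟩, h1, ?_, h2⟩
    · have := hψ n hn
      rw [h, sub_self] at this
      simp at this
    · intro y hy
      rw [hdn]
      exact (hdm _ hR).symm.trans_le (h1 y hy)

theorem IsTouching.center_notMem (hf : IsSimpleC1Loop f f' a b) (h : IsTouching f f' a b s t c) :
    c ∉ f '' Icc a b := by
  intro hc
  obtain ⟨σ, R, hσ, hR0, hR1, he⟩ := h.normal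
  have h1 := h.nearest_left c hc
  rw [dist_self] at h1
  have h2 : c = f s := dist_le_zero.1 h1
  rw [← add_smul_sideNormal, h2] at he
  have hN := hf.norm_sideNormal s hσ
  have h3 : R • sideNormal f' s σ = 0 := by simpa using he.symm
  have h4 := congrArg norm h3
  rw [norm_smul, hN, mul_one, norm_zero, Real.norm_of_nonneg hR0.le] at h4
  linarith

/-- The new first contact is the midpoint time `m`, interior even if `t` is an end. The crosscut of
the old disc confines the new second contact to the arc between `f s` and `f t`, whose times are
within `|t - s| / 2` of `m`. -/
theorem IsTouching.exists_halving (hf : IsSimpleC1Loop f f' a b) {δ : ℝ} (hδ0 : 0 < δ)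
    (hδ : IsLocallyOutside f f' a b δ)
    (hno : ∀ c, indexIntegral f f' a b c ≠ 0 → ∃ y ∈ f '' Icc a b, dist c y < 1)
    (h : IsTouching f f' a b s t c) :
    ∃ m n c', IsTouching f f' a b m n c' ∧ |n - m| ≤ |t - s| / 2 := by
  have hs := h.left_mem
  have ht := h.right_mem
  set m := (s + t) / 2 with hmdef
  have hst : t ≠ s := fun e => h.ne (by rw [e])
  have hm : m ∈ Ioo a b := by
    constructor <;> simp only [hmdef] <;> linarith [hs.1, hs.2, ht.1, ht.2]
  have hms : m ≠ s := by intro e; apply hst; linarith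
  obtain ⟨n, c', h'⟩ := hf.exists_isTouching hδ0 hδ hno hm
  -- If the two discs have the same center, the crosscut gives no information, but `f s` itself is a
  -- second contact at the required distance.
  by_cases hcc : c = c'
  · refine ⟨m, s, c', { h' with
      right_mem := Ioo_subset_Icc_self hs
      ne := fun e => hms (hf.eq_of_eq hm (Ioo_subset_Icc_self hs) e).symm
      nearest_right := hcc ▸ h.nearest_left }, ?_⟩
    have e : s - m = -(t - s) / 2 := by simp only [hmdef]; ring
    rw [e, abs_div, abs_neg, abs_two]
  · obtain ⟨σ, R, hσ, hR0, -, he⟩ := h.normal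
    have hρ : 0 < R / ‖f' s‖ := div_pos hR0 (norm_pos_iff.2 (hf.ne s))
    -- The crosscut locates the point `f n`, not the time `n`: at the base, the time must be
    -- replaced by the one at the other end.
    have key : ∀ n', n' ∈ Icc a b → f n' = f n → |n' - m| ≤ |t - s| / 2 →
        ∃ m n c', IsTouching f f' a b m n c' ∧ |n - m| ≤ |t - s| / 2 := by
      intro n' hn' e hle
      refine ⟨m, n', c', { h' with
        right_mem := hn'
        ne := e ▸ h'.ne
        nearest_right := ?_ }, hle⟩
      have := h'.nearest_right
      unfold IsNearest at this ⊢
      rwa [e]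
    rcases hst.lt_or_gt with hlt | hlt
    · obtain ⟨n', hn', e⟩ := hf.mem_image_of_touch' hs hlt ht.1 hσ hρ he h.nearest_left
        h.nearest_right h.index_ne (m := m)
        ⟨by simp only [hmdef]; linarith, by simp only [hmdef]; linarith⟩ h'.right_mem
        h'.nearest_left h'.nearest_right (h'.center_notMem hf) h'.index_ne hcc
      refine key n' ⟨ht.1.trans hn'.1, hn'.2.trans hs.2.le⟩ e ?_
      rw [abs_of_neg (sub_neg.2 hlt), abs_le]
      simp only [hmdef]
      constructor <;> linarith [hn'.1, hn'.2]
    · obtain ⟨n', hn', e⟩ := hf.mem_image_of_touch hs hlt ht.2 hσ hρ he h.nearest_left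
        h.nearest_right h.index_ne (m := m)
        ⟨by simp only [hmdef]; linarith, by simp only [hmdef]; linarith⟩ h'.right_mem
        h'.nearest_left h'.nearest_right (h'.center_notMem hf) h'.index_ne hcc
      refine key n' ⟨hs.1.le.trans hn'.1, hn'.2.trans ht.2⟩ e ?_
      rw [abs_of_pos (sub_pos.2 hlt), abs_le]
      simp only [hmdef]
      constructor <;> linarith [hn'.1, hn'.2]

/-- A simple loop that locally stays outside its tangent unit discs has an inscribed unit disc. -/
theorem exists_unit_disc (hf : IsSimpleC1Loop f f' a b) {δ : ℝ} (hδ0 : 0 < δ)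
    (hδ : IsLocallyOutside f f' a b δ) :
    ∃ c, indexIntegral f f' a b c ≠ 0 ∧ ∀ y ∈ f '' Icc a b, 1 ≤ dist c y := by
  by_contra! hno
  have hlt := hf.lt
  have hm : (a + b) / 2 ∈ Ioo a b := ⟨by linarith, by linarith⟩
  obtain ⟨n, c, h⟩ := hf.exists_isTouching hδ0 hδ hno hm
  have hiter : ∀ j : ℕ, ∃ s t c, IsTouching f f' a b s t c ∧ |t - s| ≤ (b - a) / 2 ^ j := by
    intro j
    induction j with
    | zero =>
      refine ⟨_, _, _, h, ?_⟩
      rw [pow_zero, div_one, abs_le]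
      constructor <;> linarith [h.right_mem.1, h.right_mem.2]
    | succ j ih =>
      obtain ⟨s, t, c, h, hle⟩ := ih
      obtain ⟨m, n, c', h', hle'⟩ := h.exists_halving hf hδ0 hδ hno
      refine ⟨m, n, c', h', hle'.trans ?_⟩
      rw [pow_succ, ← div_div]
      linarith
  obtain ⟨j, hj⟩ := pow_unbounded_of_one_lt ((b - a) / δ) (one_lt_two (α := ℝ))
  obtain ⟨s, t, c, h, hle⟩ := hiter j
  have h1 := h.lt_abs_sub hf hδ
  have h2 : (b - a) / 2 ^ j < δ := by
    rw [div_lt_iff₀ hδ0] at hj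
    rw [div_lt_iff₀ (by positivity)]
    linarith
  linarith

end IsSimpleC1Loop

/-! ### Extension to the line and transfer to the plane -/

theorem HasDerivWithinAt.Ici_of_Icc {E : Type*} [NormedAddCommGroup E] [NormedSpace ℝ E]
    {h : ℝ → E} {h' : E} {a b u : ℝ} (hd : HasDerivWithinAt h h' (Icc a b) u) (hu : u ∈ Ico a b) :
    HasDerivWithinAt h h' (Ici u) u :=
  hd.mono_of_mem_nhdsWithin (mem_of_superset (Icc_mem_nhdsGE hu.2) (Icc_subset_Icc_left hu.1))

/-- A curve on `[a, b]` with speed `v` and unit tangent `T`, `|T'| ≤ v`, extends to a curve on the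
line whose tangent direction is `exp (iθ)` with `|θ'|` at most the speed. -/
theorem exists_extension_of_curvature_le {g T T' : ℝ → ℂ} {v : ℝ → ℝ} {a b : ℝ} (hab : a < b)
    (hg : ∀ u ∈ Icc a b, HasDerivWithinAt g (v u * T u) (Icc a b) u)
    (hT : ∀ u ∈ Icc a b, HasDerivWithinAt T (T' u) (Icc a b) u)
    (hvc : ContinuousOn v (Icc a b)) (hT'c : ContinuousOn T' (Icc a b))
    (hv : ∀ u ∈ Icc a b, 0 < v u) (hT1 : ∀ u ∈ Icc a b, ‖T u‖ = 1)
    (hT'v : ∀ u ∈ Icc a b, ‖T' u‖ ≤ v u) :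
    ∃ (f f' : ℝ → ℂ) (V θ K : ℝ → ℝ), IsC1Curve f f' ∧ EqOn f g (Icc a b) ∧ (∀ u, 0 < V u) ∧
      (∀ u, f' u = V u * Complex.exp (θ u * Complex.I)) ∧ Continuous V ∧
      (∀ u, HasDerivAt θ (K u) u) ∧ ∀ u, |K u| ≤ V u := by
  have hTc : ContinuousOn T (Icc a b) := fun u hu => (hT u hu).continuousWithinAt
  -- Clamping to `[a, b]` keeps speed and turning rate constant beyond the ends. The extension
  -- supplies two-sided derivatives; it need not be simple outside `[a, b]`.
  set π : ℝ → ℝ := fun u => projIcc a b hab.le u with hπ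
  have hπc : Continuous π := continuous_subtype_val.comp continuous_projIcc
  have hπm : ∀ u, π u ∈ Icc a b := fun u => (projIcc a b hab.le u).2
  have hπe : ∀ u ∈ Icc a b, π u = u := fun u hu => by simp [hπ, projIcc_of_mem hab.le hu]
  set k : ℝ → ℝ := fun u => (starRingEnd ℂ (T u) * T' u).im with hk
  have hkc : ContinuousOn k (Icc a b) :=
    Complex.continuous_im.comp_continuousOn ((Complex.continuous_conj.comp_continuousOn hTc).mul hT'c)
  have hkv : ∀ u ∈ Icc a b, |k u| ≤ v u := by
    intro u hu
    refine (Complex.abs_im_le_norm _).trans ?_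
    rw [norm_mul, RCLike.norm_conj, hT1 u hu, one_mul]
    exact hT'v u hu
  set V : ℝ → ℝ := fun u => v (π u)
  set K : ℝ → ℝ := fun u => k (π u)
  have hVc : Continuous V := hvc.comp_continuous hπc hπm
  have hKc : Continuous K := hkc.comp_continuous hπc hπm
  set θ : ℝ → ℝ := fun u => (T a).arg + ∫ w in a..u, K w
  have hθd : ∀ u, HasDerivAt θ (K u) u := fun u =>
    ((hKc.integral_hasStrictDerivAt a u).hasDerivAt).const_add _
  have hθc : Continuous θ := continuous_iff_continuousAt.2 fun u => (hθd u).continuousAt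
  set f' : ℝ → ℂ := fun u => V u * Complex.exp (θ u * Complex.I)
  have hf'c : Continuous f' := by fun_prop
  set f : ℝ → ℂ := fun u => g a + ∫ w in a..u, f' w
  have hfd : ∀ u, HasDerivAt f (f' u) u := fun u =>
    ((hf'c.integral_hasStrictDerivAt a u).hasDerivAt).const_add _
  have ha : a ∈ Icc a b := ⟨le_rfl, hab.le⟩
  -- Since `‖T‖ = 1`, the derivative `T'` is orthogonal to `T`, so it is a real multiple of `I * T`.
  have hT' : ∀ u ∈ Icc a b, T' u = k u * Complex.I * T u := by
    intro u hu
    have h1 := (hT u hu).norm_sq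
    have h2 : HasDerivWithinAt (fun u => ‖T u‖ ^ 2) 0 (Icc a b) u :=
      (hasDerivWithinAt_const u _ (1 : ℝ)).congr (fun w hw => by rw [hT1 w hw, one_pow])
        (by rw [hT1 u hu, one_pow])
    have h3 := (uniqueDiffOn_Icc hab u hu).eq_deriv _ h1 h2
    rw [Complex.inner] at h3
    have h4 : T' u * starRingEnd ℂ (T u) = k u * Complex.I := by
      apply Complex.ext
      · rw [mul_comm] at h3
        simp only [Complex.re_ofReal_mul, Complex.I_re, mul_zero]
        linarith
      · simp [hk]; ring
    have h5 : starRingEnd ℂ (T u) * T u = 1 := by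
      rw [mul_comm, Complex.mul_conj, Complex.normSq_eq_norm_sq, hT1 u hu]; simp
    rw [← h4, mul_assoc, h5, mul_one]
  have hTθ : ∀ u ∈ Icc a b, T u = Complex.exp (θ u * Complex.I) := by
    intro u hu
    have hd : ∀ w ∈ Icc a b, HasDerivWithinAt
        (fun w => T w * Complex.exp (-(θ w * Complex.I))) 0 (Icc a b) w := by
      intro w hw
      have h1 : HasDerivAt (fun w => Complex.exp (-(θ w * Complex.I)))
          (Complex.exp (-(θ w * Complex.I)) * -(K w * Complex.I)) w :=
        (((hθd w).ofReal_comp.mul_const Complex.I).neg).cexp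
      refine ((hT w hw).mul h1.hasDerivWithinAt).congr_deriv ?_
      rw [hT' w hw]
      simp only [K, hπe w hw]
      ring
    have h := constant_of_has_deriv_right_zero
      (fun w hw => (hd w hw).continuousWithinAt)
      (fun w hw => (hd w (Ico_subset_Icc_self hw)).Ici_of_Icc hw) u hu
    have hθa : θ a = (T a).arg := by simp [θ]
    have h0 : T a * Complex.exp (-(θ a * Complex.I)) = 1 := by
      have e := Complex.norm_mul_exp_arg_mul_I (T a)
      rw [hT1 a ha, Complex.ofReal_one, one_mul] at e
      rw [hθa]
      nth_rw 1 [← e]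
      rw [← Complex.exp_add]; simp
    rw [h0, Complex.exp_neg, mul_inv_eq_one₀ (Complex.exp_ne_zero _)] at h
    exact h
  refine ⟨f, f', V, θ, K, ⟨hfd, hf'c⟩, fun u hu => ?_, fun u => hv _ (hπm u), fun u => rfl, hVc,
    hθd, fun u => hkv _ (hπm u)⟩
  have hd : ∀ w ∈ Icc a b, HasDerivWithinAt (fun w => f w - g w) 0 (Icc a b) w := by
    intro w hw
    refine ((hfd w).hasDerivWithinAt.sub (hg w hw)).congr_deriv ?_
    simp only [f', V, hπe w hw, hTθ w hw, sub_self]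
  have h := constant_of_has_deriv_right_zero
    (fun w hw => (hd w hw).continuousWithinAt)
    (fun w hw => (hd w (Ico_subset_Icc_self hw)).Ici_of_Icc hw) u hu
  have h0 : f a - g a = 0 := by simp [f]
  rw [h0] at h
  exact sub_eq_zero.1 h

/-- The identification of the Euclidean plane with the complex plane. -/
noncomputable def planeToComplex : Plane ≃ₗᵢ[ℝ] ℂ := Complex.orthonormalBasisOneI.repr.symm

theorem IsSimpleSmoothRegularLoop.exists_extension {γ : ℝ → Plane} {a b : ℝ}
    (hγ : IsSimpleSmoothRegularLoop γ a b)
    (hκ : ∀ t ∈ Icc a b, absCurvature γ (Icc a b) t ≤ 1) :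
    ∃ f f' : ℝ → ℂ, IsSimpleC1Loop f f' a b ∧
      (∃ δ > 0, IsC1Curve.IsLocallyOutside f f' a b δ) ∧
      EqOn f (fun u => planeToComplex (γ u)) (Icc a b) := by
  have hab := hγ.lt
  have hU := uniqueDiffOn_Icc hab
  have hγ'd : ContDiffOn ℝ ∞ (derivWithin γ (Icc a b)) (Icc a b) :=
    hγ.smooth.derivWithin hU (by simp)
  have hnd : ContDiffOn ℝ ∞ (fun u => ‖derivWithin γ (Icc a b) u‖) (Icc a b) :=
    hγ'd.norm ℝ hγ.regular
  have hpos : ∀ u ∈ Icc a b, 0 < ‖derivWithin γ (Icc a b) u‖ := fun u hu =>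
    norm_pos_iff.2 (hγ.regular u hu)
  have hTd : ContDiffOn ℝ ∞ (unitTangent γ (Icc a b)) (Icc a b) :=
    (hnd.inv fun u hu => (hpos u hu).ne').smul hγ'd
  have hT'd : ContDiffOn ℝ ∞ (derivWithin (unitTangent γ (Icc a b)) (Icc a b)) (Icc a b) :=
    hTd.derivWithin hU (by simp)
  obtain ⟨f, f', V, θ, K, hf, hfg, hV, hf', hVc, hθ, hK⟩ := exists_extension_of_curvature_le hab
    (g := fun u => planeToComplex (γ u)) (T := fun u => planeToComplex (unitTangent γ (Icc a b) u))
    (T' := fun u => planeToComplex (derivWithin (unitTangent γ (Icc a b)) (Icc a b) u))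
    (v := fun u => ‖derivWithin γ (Icc a b) u‖)
    (fun u hu => by
      have h := (hγ.smooth.differentiableOn (by simp) u hu).hasDerivWithinAt
      have h2 := planeToComplex.toContinuousLinearEquiv.hasFDerivAt.comp_hasDerivWithinAt u h
      refine h2.congr_deriv ?_
      simp only [unitTangent, map_smul, Complex.real_smul]
      rw [← mul_assoc, ← Complex.ofReal_mul, mul_inv_cancel₀ (hpos u hu).ne']
      simp)
    (fun u hu => by
      have h := (hTd.differentiableOn (by simp) u hu).hasDerivWithinAt
      exact planeToComplex.toContinuousLinearEquiv.hasFDerivAt.comp_hasDerivWithinAt u h)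
    hnd.continuousOn (planeToComplex.continuous.comp_continuousOn hT'd.continuousOn) hpos
    (fun u hu => by
      rw [LinearIsometryEquiv.norm_map, unitTangent, norm_smul, norm_inv, norm_norm,
        inv_mul_cancel₀ (hpos u hu).ne'])
    (fun u hu => by
      rw [LinearIsometryEquiv.norm_map]
      exact (div_le_one (hpos u hu)).1 (hκ u hu))
  refine ⟨f, f', ⟨hf, hab, fun t => ?_, ?_, ?_⟩, hf.exists_isLocallyOutside hV hf' hVc hθ hK, hfg⟩
  · rw [hf']
    exact mul_ne_zero (by exact_mod_cast (hV t).ne') (Complex.exp_ne_zero _)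
  · rw [hfg ⟨le_rfl, hab.le⟩, hfg ⟨hab.le, le_rfl⟩]
    simp only [hγ.closed]
  · intro x hx y hy h
    rw [hfg (Ico_subset_Icc_self hx), hfg (Ico_subset_Icc_self hy)] at h
    exact hγ.simple hx hy (planeToComplex.injective h)

theorem mainTheorem1 (γ : ℝ → Plane) (a b : ℝ) (hγ : IsSimpleSmoothRegularLoop γ a b)
    (hκ : ∀ t ∈ Set.Icc a b, absCurvature γ (Set.Icc a b) t ≤ 1) :
    ∃ c : Plane, Surrounds (γ '' Set.Icc a b) (Metric.closedBall c 1) := by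
  obtain ⟨f, f', hf, ⟨δ, hδ0, hδ⟩, hfg⟩ := hγ.exists_extension hκ
  obtain ⟨c, hc, hdist⟩ := hf.exists_unit_disc hδ0 hδ
  have himage : ∀ x, planeToComplex x ∈ f '' Icc a b → x ∈ γ '' Icc a b := by
    rintro x ⟨u, hu, e⟩
    rw [hfg hu] at e
    exact ⟨u, hu, planeToComplex.injective e⟩
  refine ⟨planeToComplex.symm c, fun x hx => ?_⟩
  by_cases hxΓ : x ∈ γ '' Icc a b
  · exact Or.inl hxΓ
  refine Or.inr ⟨hxΓ, ?_⟩
  by_contra hub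
  have hxΓ' : planeToComplex x ∉ f '' Icc a b := fun h => hxΓ (himage x h)
  have hxc : dist c (planeToComplex x) ≤ 1 := by
    rw [Metric.mem_closedBall, dist_comm, ← planeToComplex.dist_map,
      LinearIsometryEquiv.apply_symm_apply] at hx
    exact hx
  -- The segment from `c` to the point has length at most `1`, while the loop is at distance at
  -- least `1` from `c`; they could meet only at the far end, which is off the loop. So the nonzero
  -- index at `c` persists, whereas an unbounded component would give `0`.
  have h1 : indexIntegral f f' a b c = indexIntegral f f' a b (planeToComplex x) := by
    refine hf.eq_of_isPreconnected (convex_segment c (planeToComplex x)).isPreconnected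
      (fun z hz hzΓ => ?_) (left_mem_segment _ _ _) (right_mem_segment _ _ _)
    have h2 := dist_add_dist_of_mem_segment hz
    have h3 := hdist z hzΓ
    have h4 : z = planeToComplex x := dist_le_zero.1 (by linarith)
    exact hxΓ' (h4 ▸ hzΓ)
  refine hc (h1.trans ?_)
  refine hf.eq_zero_of_unbounded
    (S := planeToComplex '' connectedComponentIn (γ '' Icc a b)ᶜ x)
    (isPreconnected_connectedComponentIn.image _ planeToComplex.continuous.continuousOn) ?_ ?_
    ⟨x, mem_connectedComponentIn hxΓ, rfl⟩
  · rintro _ ⟨y, hy, rfl⟩ h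
    exact connectedComponentIn_subset _ _ hy (himage y h)
  · intro hb
    refine hub ?_
    obtain ⟨R, hR⟩ := isBounded_iff_forall_norm_le.1 hb
    exact isBounded_iff_forall_norm_le.2 ⟨R, fun y hy => by
      simpa using hR _ ⟨y, hy, rfl⟩⟩
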